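/- **Conventions.** $\mathbb{N}=\{0,1,2,\dots\}$. Let $M=(M_k)_{k\in\mathbb N}$ be a sequence of real numbers such that 1. $1=M_0\le M_k\le M_{k+1}$ for all $k$; 2. $M$ is log-convex: $M_k^2\le M_{k-1}M_{k+1}$ for all $k\ge 1$; 3. $M$ has moderate growth: $\sup_{j,k\ge 1}\left(\frac{M_{j+k}}{M_jM_k}\right)^{1/(j+k)}<\infty$. Throughout, $[M]$ stands uniformly either for $(M)$ (Beurling case) or for $\{M\}$ (Roumieu case), and likewise $[L]$ for $(L)$ or $\{L\}$ correspondingly; the symbol $\square\,\rho>0$ means $\forall\rho>0$ in the Beurling case and $\exists\rho>0$ in the Roumieu case. In the Beurling case assume in addition that $M_k^{1/k}\to\infty$. Let $L=(L_k)_{k\in\mathbb N}$ be a sequence of real numbers with $L_k\ge 1$ for all $k$, let $1\le p<\infty$ and $n\in\mathbb N$. Write $f^{(k)}$ for the $k$-th Fréchet derivative, with the operator norm, and $\partial^\alpha$ for partial derivatives. Consider the following classes of mappings. - $\mathcal B^{[M]}(\mathbb R^n,\mathbb R^n)$: all $f\in C^\infty(\mathbb R^n,\mathbb R^n)$ with $\square\,\rho>0:\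 \sup_{k\in\mathbb N,\,x\in\mathbb R^n}\dfrac{\|f^{(k)}(x)\|}{\rho^k\,k!\,M_k}<\infty$. - $W^{[M],p}(\mathbb R^n,\mathbb R^n)$: all $f=(f_1,\dots,f_n)$ such that each $f_i\in C^\infty(\mathbb R^n,\mathbb R)$ satisfies $\square\,\rho>0:\ \sup_{\alpha\in\mathbb N^n}\dfrac{\|\partial^\alpha f_i\|_{L^p(\mathbb R^n)}}{\rho^{|\alpha|}\,|\alpha|!\,M_{|\alpha|}}<\infty$. - $\mathcal S^{[M]}_{[L]}(\mathbb R^n,\mathbb R^n)$: all $f\in C^\infty(\mathbb R^n,\mathbb R^n)$ with $\square\,\rho>0:\ \sup_{m,k\in\mathbb N,\,x\in\mathbb R^n}\dfrac{(1+|x|)^m\,\|f^{(k)}(x)\|}{\rho^{m+k}\,m!\,k!\,L_m\,M_k}<\infty$. - $\mathcal D^{[M]}(\mathbb R^n,\mathbb R^n)$: all $f\in C^\infty(\mathbb R^n,\mathbb R^n)$ with compact support such that for every compact $K\subseteq\mathbb R^n$, $\square\,\rho>0:\ \sup_{k\in\mathbb N,\,x\in K}\dfrac{\|f^{(k)}(x)\|}{\rho^k\,k!\,M_k}<\infty$.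 Put $$\operatorname{Diff}\mathcal B^{[M]}(\mathbb R^n)=\Big\{\mathrm{Id}+f:\ f\in\mathcal B^{[M]}(\mathbb R^n,\mathbb R^n),\ \inf_{x\in\mathbb R^n}\det(\mathbb I_n+df(x))>0\Big\},$$ and, for $\mathcal A\in\{W^{[M],p},\mathcal S^{[M]}_{[L]},\mathcal D^{[M]}\}$, $$\operatorname{Diff}\mathcal A(\mathbb R^n)=\big\{\mathrm{Id}+f:\ f\in\mathcal A(\mathbb R^n,\mathbb R^n),\ \det(\mathbb I_n+df(x))>0\text{ for all }x\in\mathbb R^n\big\}.$$ **Proposition.** Each of $\operatorname{Diff}\mathcal B^{[M]}(\mathbb R^n)$, $\operatorname{Diff}W^{[M],p}(\mathbb R^n)$, $\operatorname{Diff}\mathcal S^{[M]}_{[L]}(\mathbb R^n)$ and $\operatorname{Diff}\mathcal D^{[M]}(\mathbb R^n)$ is a group with respect to composition: it contains the identity, it is closed under composition, and each of its elements is a bijection of $\mathbb R^n$ whose inverse again belongs to it. -/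

import Mathlib

open scoped ContDiff ENNReal

namespace DenjoyCarleman

/-- The two types of ultradifferentiable classes: Beurling, `[M] = (M)`, and Roumieu,
`[M] = {M}`. -/
inductive ClassType : Type
  | beurling : ClassType
  | roumieu : ClassType

/-- The quantifier `□ ρ > 0`: it is `∀ ρ > 0` in the Beurling case and `∃ ρ > 0` in the
Roumieu case. -/
def Box : ClassType → (ℝ → Prop) → Prop
  | ClassType.beurling, P => ∀ ρ : ℝ, 0 < ρ → P ρ
  | ClassType.roumieu, P => ∃ ρ : ℝ, 0 < ρ ∧ P ρ

/-- The standing hypotheses on the weight sequence `M`: `1 = M₀ ≤ M_k ≤ M_{k+1}`, log-convexity,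
moderate growth (`sup_{j,k ≥ 1} (M_{j+k} / (M_j M_k))^{1/(j+k)} < ∞`), and, in the Beurling case
only, `M_k^{1/k} → ∞`. -/
structure IsWeightSequence (t : ClassType) (M : ℕ → ℝ) : Prop where
  zero : M 0 = 1
  mono : Monotone M
  logConvex : ∀ k : ℕ, M (k + 1) ^ 2 ≤ M k * M (k + 2)
  moderateGrowth : ∃ C : ℝ, 0 < C ∧
    ∀ j k : ℕ, 1 ≤ j → 1 ≤ k → M (j + k) ≤ C ^ (j + k) * (M j * M k)
  beurling : t = ClassType.beurling →
    Filter.Tendsto (fun k : ℕ => M k ^ (1 / (k : ℝ))) Filter.atTop Filter.atTop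

section Classes

variable {E F : Type*} [NormedAddCommGroup E] [NormedSpace ℝ E]
  [NormedAddCommGroup F] [NormedSpace ℝ F]

/-- The global Denjoy–Carleman class `𝓑^[M](E, F)`. The existence of `C` expresses that the
supremum of the quotients `‖f^(k)(x)‖ / (ρ^k k! M_k)` over all `k` and `x` is finite. -/
def MemB (t : ClassType) (M : ℕ → ℝ) (f : E → F) : Prop :=
  ContDiff ℝ ∞ f ∧
    Box t fun ρ => ∃ C : ℝ, ∀ (k : ℕ) (x : E),
      ‖iteratedFDeriv ℝ k f x‖ ≤ C * (ρ ^ k * (k.factorial : ℝ) * M k)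

/-- The Gelfand–Shilov class `𝓢_[L]^[M](E, F)`. -/
def MemS (t : ClassType) (L M : ℕ → ℝ) (f : E → F) : Prop :=
  ContDiff ℝ ∞ f ∧
    Box t fun σ => ∃ C : ℝ, ∀ (p q : ℕ) (x : E),
      (1 + ‖x‖) ^ p * ‖iteratedFDeriv ℝ q f x‖ ≤
        C * (σ ^ (p + q) * (p.factorial : ℝ) * (q.factorial : ℝ) * L p * M q)

/-- The local Denjoy–Carleman class `C^[M](E, F)`. -/
def MemC (t : ClassType) (M : ℕ → ℝ) (f : E → F) : Prop :=
  ContDiff ℝ ∞ f ∧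
    ∀ K : Set E, IsCompact K → Box t fun ρ => ∃ C : ℝ, ∀ (k : ℕ), ∀ x ∈ K,
      ‖iteratedFDeriv ℝ k f x‖ ≤ C * (ρ ^ k * (k.factorial : ℝ) * M k)

/-- The class `𝓓^[M](E, F)` of `C^[M]`-mappings with compact support. -/
def MemD (t : ClassType) (M : ℕ → ℝ) (f : E → F) : Prop :=
  MemC t M f ∧ HasCompactSupport f

end Classes

/-- The partial derivative `∂^α f (x)` of a scalar function on `ℝⁿ`, `α ∈ ℕⁿ`: the derivative of
order `|α| = α₁ + ⋯ + αₙ` of `f` at `x`, applied to `α₁` copies of `e₁`, ..., `αₙ` copies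
of `eₙ`. -/
noncomputable def multiDeriv {n : ℕ} (α : Fin n → ℕ) (f : EuclideanSpace ℝ (Fin n) → ℝ)
    (x : EuclideanSpace ℝ (Fin n)) : ℝ :=
  iteratedFDeriv ℝ (∑ i, α i) f x
    fun j => EuclideanSpace.single (finSigmaFinEquiv.symm j).1 (1 : ℝ)

/-- The scalar Sobolev–Denjoy–Carleman class `W^{[M],p}(ℝⁿ)`, defined by Lebesgue `p`-norms of
the partial derivatives. -/
def MemWScalar {n : ℕ} (t : ClassType) (M : ℕ → ℝ) (p : ℝ≥0∞)
    (f : EuclideanSpace ℝ (Fin n) → ℝ) : Prop :=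
  ContDiff ℝ ∞ f ∧
    Box t fun σ => ∃ C : ℝ, ∀ α : Fin n → ℕ,
      MeasureTheory.eLpNorm (multiDeriv α f) p MeasureTheory.volume ≤
        ENNReal.ofReal
          (C * (σ ^ (∑ i, α i) * ((∑ i, α i).factorial : ℝ) * M (∑ i, α i)))

/-- `W^{[M],p}(ℝⁿ, ℝⁿ) = (W^{[M],p}(ℝⁿ))ⁿ`. -/
def MemW {n : ℕ} (t : ClassType) (M : ℕ → ℝ) (p : ℝ≥0∞)
    (f : EuclideanSpace ℝ (Fin n) → EuclideanSpace ℝ (Fin n)) : Prop :=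
  ∀ i : Fin n, MemWScalar t M p fun x => f x i

/-- The Jacobian determinant `det (𝕀ₙ + df(x))` of `Id + f` at `x`. -/
noncomputable def jacDet {n : ℕ} (f : EuclideanSpace ℝ (Fin n) → EuclideanSpace ℝ (Fin n))
    (x : EuclideanSpace ℝ (Fin n)) : ℝ :=
  (ContinuousLinearMap.id ℝ (EuclideanSpace ℝ (Fin n)) + fderiv ℝ f x).det

/-- `Diff 𝓑^[M](ℝⁿ)`: the mappings `Id + f` with `f ∈ 𝓑^[M](ℝⁿ, ℝⁿ)` and
`inf_x det (𝕀ₙ + df(x)) > 0`. -/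
def DiffB (n : ℕ) (t : ClassType) (M : ℕ → ℝ) :
    Set (EuclideanSpace ℝ (Fin n) → EuclideanSpace ℝ (Fin n)) :=
  {F | ∃ f, (∀ x, F x = x + f x) ∧ MemB t M f ∧ ∃ c : ℝ, 0 < c ∧ ∀ x, c ≤ jacDet f x}

/-- `Diff W^{[M],p}(ℝⁿ)`: the mappings `Id + f` with `f ∈ W^{[M],p}(ℝⁿ, ℝⁿ)` and
`det (𝕀ₙ + df) > 0`. -/
def DiffW (n : ℕ) (t : ClassType) (M : ℕ → ℝ) (p : ℝ≥0∞) :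
    Set (EuclideanSpace ℝ (Fin n) → EuclideanSpace ℝ (Fin n)) :=
  {F | ∃ f, (∀ x, F x = x + f x) ∧ MemW t M p f ∧ ∀ x, 0 < jacDet f x}

/-- `Diff 𝓢_[L]^[M](ℝⁿ)`: the mappings `Id + f` with `f ∈ 𝓢_[L]^[M](ℝⁿ, ℝⁿ)` and
`det (𝕀ₙ + df) > 0`. -/
def DiffS (n : ℕ) (t : ClassType) (L M : ℕ → ℝ) :
    Set (EuclideanSpace ℝ (Fin n) → EuclideanSpace ℝ (Fin n)) :=
  {F | ∃ f, (∀ x, F x = x + f x) ∧ MemS t L M f ∧ ∀ x, 0 < jacDet f x}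

/-- `Diff 𝓓^[M](ℝⁿ)`: the mappings `Id + f` with `f ∈ 𝓓^[M](ℝⁿ, ℝⁿ)` and
`det (𝕀ₙ + df) > 0`. -/
def DiffD (n : ℕ) (t : ClassType) (M : ℕ → ℝ) :
    Set (EuclideanSpace ℝ (Fin n) → EuclideanSpace ℝ (Fin n)) :=
  {F | ∃ f, (∀ x, F x = x + f x) ∧ MemD t M f ∧ ∀ x, 0 < jacDet f x}

/-- A set `S` of self-maps of `X` is a group with respect to composition (with neutral element
the identity): it contains the identity, it is closed under composition, and every element of `S`
is a bijection of `X` whose inverse lies in `S`. -/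
def IsGroupUnderComposition {X : Type*} (S : Set (X → X)) : Prop :=
  id ∈ S ∧ (∀ F ∈ S, ∀ G ∈ S, F ∘ G ∈ S) ∧
    ∀ F ∈ S, ∃ G ∈ S, F ∘ G = id ∧ G ∘ F = id

end DenjoyCarleman

/-! Everything reduces to inverting Id + f inside the class 𝓑. The composite (Id + f) ∘ (Id + g)
equals Id + (g + f ∘ (Id + g)), and if it is the identity then g = -f ∘ (Id + g). Hence an additive
group of perturbations contained in 𝓑 and stable under f ↦ f ∘ (Id + g), with Id + g in `DiffB`,
inherits the group property (`isGroupUnderComposition_of_class`). In 𝓢, 𝓓 and W the differential of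
f tends to 0 at infinity, so the Jacobian determinant tends to 1 and its positivity already bounds
it away from 0. Stability under composition holds in 𝓢 because Id + g displaces points boundedly, in
𝓓 because it is proper, and in W by change of variables. The inclusion of W in 𝓑 is a Sobolev
inequality on unit cubes, whose loss of n derivatives is absorbed by moderate growth.

For 𝓑, the map F = Id + f is proper, so Hadamard's theorem gives a smooth global inverse G, and G' =
H ∘ G with H = (F')⁻¹. Its derivatives are estimated by majorants. The Faà di Bruno inequality is
phrased through coefficients of powers of a power series, log-convexity extracts the weights from
these coefficients, and Catalan numbers serve as an auxiliary factor because their self-convolution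
costs only a factor 4; at the end they are replaced by 4^k. Induction bounds first H, from H' = -H
F'' H, and then G, from the autonomous equation (`exists_bound_of_rightInverse`).

This is a Roumieu argument. A Beurling estimate is turned into a Roumieu estimate for one log-convex
sequence N that is smaller than M by more than any geometric factor
(`exists_isLogConvexWeight_of_beurling`). -/

set_option maxSynthPendingDepth 3

namespace DenjoyCarleman

/-! ### Coefficients of powers of power series -/

section Combinatorics

open Finset PowerSeries

/-- Coefficient form of (P^(j+1))' = (j+1) P^j P'. It matches the Leibniz rule for (f' ∘ g) · g', so
the induction behind the Faà di Bruno inequality closes. -/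
theorem succ_mul_coeff_succ_pow_succ (P : PowerSeries ℝ) (j k : ℕ) :
    ((k : ℝ) + 1) * coeff (k + 1) (P ^ (j + 1)) =
      ((j : ℝ) + 1) * ∑ q ∈ antidiagonal k,
        coeff q.1 (P ^ j) * (((q.2 : ℝ) + 1) * coeff (q.2 + 1) P) := by
  have h : PowerSeries.derivative ℝ (P ^ (j + 1)) =
      ((j : ℝ) + 1) • (P ^ j * PowerSeries.derivative ℝ P) := by
    rw [Derivation.leibniz_pow]
    simp only [Nat.add_sub_cancel, smul_eq_mul, nsmul_eq_mul]
    rw [PowerSeries.smul_eq_C_mul]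
    push_cast
    simp
  have h2 := congrArg (coeff k) h
  rw [PowerSeries.coeff_derivative, PowerSeries.coeff_smul, PowerSeries.coeff_mul] at h2
  simp only [PowerSeries.coeff_derivative] at h2
  rw [mul_comm, h2, smul_eq_mul]
  simp only [mul_comm]

theorem coeff_pow_nonneg {P : PowerSeries ℝ} (hP : ∀ i, 0 ≤ coeff i P) (j k : ℕ) :
    0 ≤ coeff k (P ^ j) := by
  induction j generalizing k with
  | zero => rw [pow_zero, coeff_one]; split_ifs <;> norm_num
  | succ j ih =>
    rw [pow_succ, coeff_mul]
    exact sum_nonneg fun q _ => mul_nonneg (ih _) (hP _)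

end Combinatorics

/-! ### Composition estimates: Faà di Bruno, log-convex weights, Catalan majorants -/

section Composition

open Finset PowerSeries

universe u

variable {E F : Type u} [NormedAddCommGroup E] [NormedSpace ℝ E]
  [NormedAddCommGroup F] [NormedSpace ℝ F]

/-- Leibniz' rule in the normalization of exponential generating functions. -/
theorem norm_iteratedFDeriv_bilinear_le_antidiagonal {A B D : Type*} [NormedAddCommGroup A]
    [NormedSpace ℝ A] [NormedAddCommGroup B] [NormedSpace ℝ B] [NormedAddCommGroup D]
    [NormedSpace ℝ D] (T : A →L[ℝ] B →L[ℝ] D) (hT : ‖T‖ ≤ 1) {a : E → A} {b : E → B}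
    (ha : ContDiff ℝ ∞ a) (hb : ContDiff ℝ ∞ b) (x : E) (k : ℕ) {u v : ℕ → ℝ}
    (hu : ∀ i ≤ k, ‖iteratedFDeriv ℝ i a x‖ ≤ i.factorial * u i)
    (hv : ∀ i ≤ k, ‖iteratedFDeriv ℝ i b x‖ ≤ i.factorial * v i) :
    ‖iteratedFDeriv ℝ k (fun y => T (a y) (b y)) x‖ ≤
      k.factorial * ∑ q ∈ antidiagonal k, u q.1 * v q.2 := by
  refine (T.norm_iteratedFDeriv_le_of_bilinear_of_le_one ha hb x
    (n := k) (by exact_mod_cast le_top) hT).trans ?_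
  rw [Nat.sum_antidiagonal_eq_sum_range_succ (fun i m => u i * v m), mul_sum]
  refine sum_le_sum fun i hi => ?_
  have hik : i ≤ k := Nat.lt_succ_iff.1 (mem_range.1 hi)
  calc (k.choose i : ℝ) * ‖iteratedFDeriv ℝ i a x‖ * ‖iteratedFDeriv ℝ (k - i) b x‖
      ≤ (k.choose i : ℝ) * (i.factorial * u i) * ((k - i).factorial * v (k - i)) := by
        have h1 := hu i hik
        have h2 := hv (k - i) (Nat.sub_le _ _)
        have h3 : 0 ≤ (i.factorial : ℝ) * u i := (norm_nonneg _).trans h1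
        gcongr
    _ = ((k.choose i * i.factorial * (k - i).factorial : ℕ) : ℝ) * (u i * v (k - i)) := by
        push_cast; ring
    _ = k.factorial * (u i * v (k - i)) := by rw [Nat.choose_mul_factorial_mul_factorial hik]

/-- A Faà di Bruno inequality: the `k`-th derivative of a composition is controlled by the
coefficients of the powers of a majorant of the inner function. -/
theorem norm_iteratedFDeriv_comp_le_coeff {G : Type u} [NormedAddCommGroup G] [NormedSpace ℝ G]
    {f : F → G} {g : E → F} (hf : ContDiff ℝ ∞ f) (hg : ContDiff ℝ ∞ g) (x : E)
    {P : PowerSeries ℝ} (hP : ∀ i, 0 ≤ coeff i P) (k : ℕ)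
    (hgP : ∀ i, 1 ≤ i → i ≤ k → ‖iteratedFDeriv ℝ i g x‖ ≤ i.factorial * coeff i P) :
    ‖iteratedFDeriv ℝ k (f ∘ g) x‖ ≤ k.factorial * ∑ j ∈ range (k + 1),
      coeff k (P ^ j) * (‖iteratedFDeriv ℝ j f (g x)‖ / j.factorial) := by
  -- The hypothesis is applied to `fderiv ℝ f`, with values in `F →L[ℝ] G`, so `G` must vary; the
  -- common universe permits this.
  induction k using Nat.strong_induction_on generalizing G with
  | _ k ih =>
  rcases k with _ | k
  · simp
  have hf' : ContDiff ℝ ∞ (fderiv ℝ f) := hf.fderiv_right (by simp)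
  have hg' : ContDiff ℝ ∞ (fderiv ℝ g) := hg.fderiv_right (by simp)
  have hfd : fderiv ℝ (f ∘ g) =
      fun y => ContinuousLinearMap.compL ℝ E F G ((fderiv ℝ f ∘ g) y) (fderiv ℝ g y) := by
    ext1 y
    rw [fderiv_comp _ (hf.differentiable (by simp) _) (hg.differentiable (by simp) _)]
    rfl
  rw [← norm_iteratedFDeriv_fderiv, hfd]
  set w : ℕ → ℝ := fun j => ‖iteratedFDeriv ℝ (j + 1) f (g x)‖ / j.factorial with hw
  have hw0 : ∀ j, 0 ≤ w j := fun j => by positivity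
  refine (norm_iteratedFDeriv_bilinear_le_antidiagonal (ContinuousLinearMap.compL ℝ E F G)
    (ContinuousLinearMap.norm_compL_le _ _ _ _) (hf'.comp hg) hg' x k
    (u := fun i => ∑ j ∈ range (k + 1), coeff i (P ^ j) * w j)
    (v := fun m => ((m : ℝ) + 1) * coeff (m + 1) P) ?_ ?_).trans ?_
  · intro i hi
    refine (ih i (by omega) hf' (fun l h1 h2 => hgP l h1 (by omega))).trans ?_
    gcongr (i.factorial : ℝ) * ?_
    simp only [norm_iteratedFDeriv_fderiv]
    exact sum_le_sum_of_subset_of_nonneg (range_mono (by omega))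
      fun j _ _ => mul_nonneg (coeff_pow_nonneg hP _ _) (hw0 j)
  · intro m hm
    rw [norm_iteratedFDeriv_fderiv]
    refine (hgP (m + 1) (by omega) (by omega)).trans (le_of_eq ?_)
    rw [Nat.factorial_succ]
    push_cast
    ring
  -- The summand j = 0 is nonnegative and is discarded; the remaining ones agree by the coefficient
  -- identity.
  · rw [sum_range_succ' _ (k + 1)]
    have h0 : 0 ≤ coeff (k + 1) (P ^ 0) * (‖iteratedFDeriv ℝ 0 f (g x)‖ / (Nat.factorial 0 : ℕ)) :=
      mul_nonneg (coeff_pow_nonneg hP _ _) (by positivity)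
    have h1 : (k.factorial : ℝ) * ∑ q ∈ antidiagonal k, (∑ j ∈ range (k + 1),
          coeff q.1 (P ^ j) * w j) * (((q.2 : ℝ) + 1) * coeff (q.2 + 1) P) =
        (k + 1).factorial * ∑ j ∈ range (k + 1), coeff (k + 1) (P ^ (j + 1)) *
          (‖iteratedFDeriv ℝ (j + 1) f (g x)‖ / (j + 1).factorial) := by
      simp_rw [sum_mul]
      rw [sum_comm, mul_sum, mul_sum]
      refine sum_congr rfl fun j _ => ?_
      have h2 := succ_mul_coeff_succ_pow_succ P j k
      calc (k.factorial : ℝ) * ∑ q ∈ antidiagonal k, coeff q.1 (P ^ j) * w j *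
            (((q.2 : ℝ) + 1) * coeff (q.2 + 1) P)
          = k.factorial * w j * ∑ q ∈ antidiagonal k, coeff q.1 (P ^ j) *
            (((q.2 : ℝ) + 1) * coeff (q.2 + 1) P) := by
            rw [mul_assoc, mul_sum (a := w j)]
            congr 1
            exact sum_congr rfl fun q _ => by ring
        _ = _ := by
            simp only [hw, Nat.factorial_succ, Nat.cast_mul, Nat.cast_succ]
            generalize ∑ q ∈ antidiagonal k, coeff q.1 (P ^ j) *
              (((q.2 : ℝ) + 1) * coeff (q.2 + 1) P) = T at h2 ⊢
            field_simp
            linear_combination (-‖iteratedFDeriv ℝ (j + 1) f (g x)‖) * h2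
    rw [h1]
    gcongr
    linarith

/-- Log-convexity of a positive sequence `N` with `N 0 = 1`. -/
structure IsLogConvexWeight (N : ℕ → ℝ) : Prop where
  zero : N 0 = 1
  pos : ∀ k, 0 < N k
  logConvex : ∀ k, N (k + 1) ^ 2 ≤ N k * N (k + 2)

namespace IsLogConvexWeight

variable {N : ℕ → ℝ}

/-- Log-convexity makes the ratios N (k+1) / N k increasing; here the ratios at a and a + d are
compared. -/
theorem succ_mul_le (hN : IsLogConvexWeight N) (a d : ℕ) :
    N (a + 1) * N (a + d) ≤ N a * N (a + d + 1) := by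
  induction d with
  | zero => simp [mul_comm]
  | succ d ih =>
    have h1 := hN.logConvex (a + d)
    have p1 := hN.pos (a + d + 1)
    have p2 := hN.pos (a + d)
    have p3 := hN.pos a
    have p4 := hN.pos (a + d + 2)
    have h2 : N (a + 1) * N (a + d + 1) * N (a + d) ≤ N a * N (a + d + 2) * N (a + d) := by
      nlinarith [mul_le_mul_of_nonneg_right ih p1.le, mul_le_mul_of_nonneg_left h1 p3.le]
    exact le_of_mul_le_mul_right h2 p2

theorem mul_le (hN : IsLogConvexWeight N) (a b : ℕ) :
    N (a + 1) * N (b + 1) ≤ N 1 * N (a + b + 1) := by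
  induction b with
  | zero => simp [mul_comm]
  | succ b ih =>
    have h1 := hN.succ_mul_le (b + 1) a
    rw [show b + 1 + a = a + b + 1 by ring] at h1
    have p1 := hN.pos (b + 1)
    have p2 := hN.pos (a + b + 1)
    have p3 := hN.pos (b + 2)
    have p4 := hN.pos 1
    have h2 : N (a + 1) * N (b + 2) * N (b + 1) ≤ N 1 * N (a + b + 2) * N (b + 1) := by
      nlinarith [mul_le_mul_of_nonneg_right ih p3.le, mul_le_mul_of_nonneg_left h1 p4.le]
    exact le_of_mul_le_mul_right h2 p1

/-- Since Q has no constant term, a coefficient of P^j involves only products of j weights with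
indices at least 1. Multiplying by N (j + r) and merging these weights one at a time by `mul_le`
costs one N 1 each and lowers the index by one each. The shift r is 0 for composition with a given
map and 1 for the differential equation. -/
theorem mul_coeff_pow_le (hN : IsLogConvexWeight N) {P Q : PowerSeries ℝ}
    (hQ : ∀ i, 0 ≤ coeff i Q) (hQ0 : coeff 0 Q = 0) (hPQ : ∀ i, coeff i P = N i * coeff i Q)
    (j r k : ℕ) :
    N (j + r) * coeff k (P ^ j) ≤ N 1 ^ j * N (r + k) * coeff k (Q ^ j) := by
  induction j generalizing r k with
  | zero =>
    rcases k with _ | k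
    · simp
    · simp [coeff_one]
  | succ j ih =>
    rw [pow_succ P, pow_succ Q, pow_succ (N 1), coeff_mul, coeff_mul, mul_sum, mul_sum]
    refine sum_le_sum fun q hq => ?_
    obtain ⟨i, m⟩ := q
    obtain rfl : i + m = k := mem_antidiagonal.1 hq
    rcases m with _ | m
    · simp [hPQ, hQ0]
    · rw [hPQ]
      have hP : ∀ i, 0 ≤ coeff i P := fun i => by
        rw [hPQ]; exact mul_nonneg (hN.pos _).le (hQ _)
      have h1 := hN.mul_le (j + r) m
      have h2 := ih (r + m + 1) i
      have c1 := coeff_pow_nonneg hP j i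
      have c2 := hQ (m + 1)
      have p1 := hN.pos 1
      calc N (j + 1 + r) * (coeff i (P ^ j) * (N (m + 1) * coeff (m + 1) Q))
          = N (j + r + 1) * N (m + 1) * (coeff i (P ^ j) * coeff (m + 1) Q) := by
            rw [show j + 1 + r = j + r + 1 by ring]; ring
        _ ≤ N 1 * N (j + r + m + 1) * (coeff i (P ^ j) * coeff (m + 1) Q) := by gcongr
        _ = N 1 * coeff (m + 1) Q * (N (j + (r + m + 1)) * coeff i (P ^ j)) := by
            rw [show j + (r + m + 1) = j + r + m + 1 by ring]; ring
        _ ≤ N 1 * coeff (m + 1) Q * (N 1 ^ j * N (r + m + 1 + i) * coeff i (Q ^ j)) := by gcongr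
        _ = _ := by rw [show r + m + 1 + i = r + (i + (m + 1)) by ring]; ring

end IsLogConvexWeight

/-- From (n+2) C_{n+1} = 2(2n+1) C_n. As C_{n+1} is the self-convolution of the Catalan numbers,
bounds of the form a R^i C_i survive Cauchy products up to a factor 4. -/
theorem catalan_succ_le (n : ℕ) : catalan (n + 1) ≤ 4 * catalan n := by
  have h1 := succ_mul_catalan_eq_centralBinom n
  have h2 := succ_mul_catalan_eq_centralBinom (n + 1)
  have h3 := Nat.succ_mul_centralBinom_succ n
  rw [← h1, ← h2] at h3
  have h4 : (n + 2) * catalan (n + 1) = 2 * (2 * n + 1) * catalan n := by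
    have : (n + 1) * ((n + 2) * catalan (n + 1)) =
        (n + 1) * (2 * (2 * n + 1) * catalan n) := by linarith
    exact Nat.eq_of_mul_eq_mul_left (Nat.succ_pos n) this
  have h5 : (n + 2) * catalan (n + 1) ≤ (n + 2) * (4 * catalan n) := by nlinarith
  exact Nat.le_of_mul_le_mul_left h5 (by omega)

theorem one_le_catalan (n : ℕ) : 1 ≤ catalan n := by
  have h1 := succ_mul_catalan_eq_centralBinom n
  have h2 := Nat.centralBinom_pos n
  rcases Nat.eq_zero_or_pos (catalan n) with h | h
  · simp [h] at h1; omega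
  · exact h

theorem catalan_le_four_pow (n : ℕ) : catalan n ≤ 4 ^ n := by
  induction n with
  | zero => simp
  | succ n ih => rw [pow_succ]; linarith [catalan_succ_le n]

theorem catalan_le_succ (n : ℕ) : catalan n ≤ catalan (n + 1) := by
  rw [catalan_succ']
  have h : (n, 0) ∈ antidiagonal n := by simp
  simpa using single_le_sum (f := fun q : ℕ × ℕ => catalan q.1 * catalan q.2)
    (fun _ _ => Nat.zero_le _) h

theorem sum_antidiagonal_catalan_le (k : ℕ) :
    ∑ q ∈ antidiagonal k, (catalan q.1 : ℝ) * catalan q.2 ≤ 4 * catalan k := by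
  have h := catalan_succ_le k
  rw [catalan_succ'] at h
  exact_mod_cast h

theorem sum_antidiagonal_le_catalan {u v : ℕ → ℝ} {a b R : ℝ} (ha : 0 ≤ a) (hb : 0 ≤ b)
    (hR : 0 ≤ R) {k : ℕ}
    (hv0 : ∀ i ≤ k, 0 ≤ v i) (hu : ∀ i ≤ k, u i ≤ a * R ^ i * catalan i)
    (hv : ∀ i ≤ k, v i ≤ b * R ^ i * catalan i) :
    ∑ q ∈ antidiagonal k, u q.1 * v q.2 ≤ a * b * 4 * R ^ k * catalan k := by
  calc ∑ q ∈ antidiagonal k, u q.1 * v q.2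
      ≤ ∑ q ∈ antidiagonal k, a * b * R ^ k * ((catalan q.1 : ℝ) * catalan q.2) := by
        refine sum_le_sum fun q hq => ?_
        obtain ⟨i, m⟩ := q
        obtain rfl : i + m = k := mem_antidiagonal.1 hq
        calc u i * v m ≤ (a * R ^ i * catalan i) * (b * R ^ m * catalan m) :=
              mul_le_mul (hu i (by omega)) (hv m (by omega)) (hv0 m (by omega)) (by positivity)
          _ = _ := by rw [pow_add]; ring
    _ ≤ a * b * R ^ k * (4 * catalan k) := by
        rw [← mul_sum]
        gcongr
        exact sum_antidiagonal_catalan_le k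
    _ = _ := by ring

/-- The shifts p and q record how far the weight index runs ahead of the order of differentiation,
beyond the unit that `mul_le` requires. -/
theorem IsLogConvexWeight.sum_antidiagonal_le {N : ℕ → ℝ} (hN : IsLogConvexWeight N)
    {u v : ℕ → ℝ} {a b R : ℝ} (ha : 0 ≤ a) (hb : 0 ≤ b) (hR : 0 ≤ R) (p q : ℕ) {k : ℕ}
    (hv0 : ∀ i ≤ k, 0 ≤ v i) (hu : ∀ i ≤ k, u i ≤ a * R ^ i * catalan i * N (i + p + 1))
    (hv : ∀ i ≤ k, v i ≤ b * R ^ i * catalan i * N (i + q + 1)) :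
    ∑ s ∈ antidiagonal k, u s.1 * v s.2 ≤
      4 * a * b * N 1 * R ^ k * catalan k * N (k + p + q + 1) := by
  have hN0 := fun k => (hN.pos k).le
  calc ∑ s ∈ antidiagonal k, u s.1 * v s.2
      ≤ ∑ s ∈ antidiagonal k, a * b * N 1 * R ^ k * N (k + p + q + 1) *
          ((catalan s.1 : ℝ) * catalan s.2) := by
        refine sum_le_sum fun s hs => ?_
        obtain ⟨i, m⟩ := s
        obtain rfl : i + m = k := mem_antidiagonal.1 hs
        have h1 := hN.mul_le (i + p) (m + q)
        have p1 := hN0 (i + p + 1)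
        have p2 := hN0 (m + q + 1)
        calc u i * v m
            ≤ (a * R ^ i * catalan i * N (i + p + 1)) * (b * R ^ m * catalan m * N (m + q + 1)) :=
              mul_le_mul (hu i (by omega)) (hv m (by omega)) (hv0 m (by omega)) (by positivity)
          _ = a * b * R ^ (i + m) * (catalan i * catalan m) *
                (N (i + p + 1) * N (m + q + 1)) := by rw [pow_add]; ring
          _ ≤ a * b * R ^ (i + m) * (catalan i * catalan m) *
                (N 1 * N (i + p + (m + q) + 1)) := by gcongr
          _ = _ := by rw [show i + p + (m + q) + 1 = i + m + p + q + 1 by ring]; ring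
    _ ≤ a * b * N 1 * R ^ k * N (k + p + q + 1) * (4 * catalan k) := by
        rw [← mul_sum]
        have p1 := hN0 1
        have p2 := hN0 (k + p + q + 1)
        gcongr
        exact sum_antidiagonal_catalan_le k
    _ = _ := by ring

theorem coeff_pow_le_catalan {Q : PowerSeries ℝ} {A R : ℝ} (hA : 0 ≤ A) (hR : 0 ≤ R)
    (hQ : ∀ i, 0 ≤ coeff i Q) {k : ℕ} (hQR : ∀ i ≤ k, coeff i Q ≤ A * R ^ i * catalan i) (j : ℕ) :
    coeff k (Q ^ j) ≤ (4 * A) ^ j * R ^ k * catalan k := by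
  induction j generalizing k with
  | zero =>
    rw [pow_zero, coeff_one]
    split_ifs with h
    · simp [h]
    · positivity
  | succ j ih =>
    rw [pow_succ, coeff_mul]
    refine (sum_antidiagonal_le_catalan (by positivity) hA hR (fun i _ => hQ i)
      (fun i hi => ih fun l hl => hQR l (hl.trans hi)) hQR).trans (le_of_eq ?_)
    ring

/-- Derivatives of a composition whose inner function has its derivatives at `x` bounded by a
log-convex sequence. -/
theorem norm_iteratedFDeriv_comp_le_weight {G : Type u} [NormedAddCommGroup G] [NormedSpace ℝ G]
    {N : ℕ → ℝ} (hN : IsLogConvexWeight N)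
    {f : F → G} {g : E → F} (hf : ContDiff ℝ ∞ f) (hg : ContDiff ℝ ∞ g) (x : E) {A R : ℝ}
    (hA : 0 ≤ A) (hR : 0 ≤ R) (k r : ℕ)
    (hgA : ∀ i, 1 ≤ i → i ≤ k →
      ‖iteratedFDeriv ℝ i g x‖ ≤ i.factorial * (N i * (A * R ^ i * catalan i))) :
    ‖iteratedFDeriv ℝ k (f ∘ g) x‖ ≤ k.factorial * (N (k + r) * (R ^ k * catalan k)) *
      ∑ j ∈ range (k + 1),
        (4 * A * N 1) ^ j * (‖iteratedFDeriv ℝ j f (g x)‖ / (j.factorial * N (j + r))) := by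
  -- The constant coefficient is zero: only derivatives of g of positive order enter, and
  -- `mul_coeff_pow_le` requires it.
  set Q : PowerSeries ℝ := mk fun i => if i = 0 then 0 else A * R ^ i * catalan i with hQ
  set P : PowerSeries ℝ := mk fun i => N i * coeff i Q with hP
  have hQ0 : ∀ i, 0 ≤ coeff i Q := fun i => by
    rw [hQ, coeff_mk]; split_ifs <;> positivity
  have hQle : ∀ i, coeff i Q ≤ A * R ^ i * catalan i := fun i => by
    rw [hQ, coeff_mk]; split_ifs
    · positivity
    · exact le_rfl
  have hP0 : ∀ i, 0 ≤ coeff i P := fun i => by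
    rw [hP, coeff_mk]; exact mul_nonneg (hN.pos i).le (hQ0 i)
  refine (norm_iteratedFDeriv_comp_le_coeff hf hg x hP0 k fun i h1 h2 => ?_).trans ?_
  · refine (hgA i h1 h2).trans (le_of_eq ?_)
    rw [hP, coeff_mk, hQ, coeff_mk, if_neg (by omega)]
  · rw [mul_assoc]
    gcongr
    rw [mul_sum]
    refine sum_le_sum fun j _ => ?_
    have h1 := hN.mul_coeff_pow_le (P := P) hQ0 (by simp [hQ])
      (fun i => by rw [hP, coeff_mk]) j r k
    have h2 := coeff_pow_le_catalan hA hR hQ0 (k := k) (fun i _ => hQle i) j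
    have p1 := hN.pos (j + r)
    have p2 := hN.pos 1
    have p3 := hN.pos (r + k)
    have h3 : coeff k (P ^ j) ≤
        N 1 ^ j * N (r + k) * ((4 * A) ^ j * R ^ k * catalan k) / N (j + r) := by
      rw [le_div_iff₀ p1, mul_comm]
      exact h1.trans (by gcongr)
    calc coeff k (P ^ j) * (‖iteratedFDeriv ℝ j f (g x)‖ / j.factorial)
        ≤ N 1 ^ j * N (r + k) * ((4 * A) ^ j * R ^ k * catalan k) / N (j + r) *
          (‖iteratedFDeriv ℝ j f (g x)‖ / j.factorial) := by gcongr
      _ = _ := by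
          rw [add_comm r k, mul_pow (4 * A)]
          field_simp

end Composition

/-! ### Derivatives of the pointwise inverse of an operator-valued map -/

section Inverse

open Finset

universe u

variable {E : Type u} [NormedAddCommGroup E] [NormedSpace ℝ E]

theorem hasFDerivAt_of_mul_eq_one {A : Type*} [NormedRing A] [HasSummableGeomSeries A]
    [NormedAlgebra ℝ A] {Φ H : E → A} (hΦ : Differentiable ℝ Φ)
    (h1 : ∀ x, Φ x * H x = 1) (h2 : ∀ x, H x * Φ x = 1) (x : E) :
    HasFDerivAt H ((-ContinuousLinearMap.mulLeftRight ℝ A (H x) (H x)).comp (fderiv ℝ Φ x)) x := by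
  let φ : E → Aˣ := fun y => ⟨Φ y, H y, h1 y, h2 y⟩
  have hH : H = Ring.inverse ∘ Φ := by
    ext1 y
    exact (Ring.inverse_unit (φ y)).symm
  have h := (hasFDerivAt_ringInverse (𝕜 := ℝ) (φ x)).comp x (hΦ x).hasFDerivAt
  exact h.congr_of_eventuallyEq (Filter.EventuallyEq.of_eq hH)

theorem contDiff_of_mul_eq_one {A : Type*} [NormedRing A] [HasSummableGeomSeries A]
    [NormedAlgebra ℝ A] {Φ H : E → A} (hΦ : ContDiff ℝ ∞ Φ)
    (h1 : ∀ x, Φ x * H x = 1) (h2 : ∀ x, H x * Φ x = 1) : ContDiff ℝ ∞ H := by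
  let φ : E → Aˣ := fun y => ⟨Φ y, H y, h1 y, h2 y⟩
  have hH : H = fun y => Ring.inverse (Φ y) := by
    ext1 y
    exact (Ring.inverse_unit (φ y)).symm
  rw [hH, contDiff_iff_contDiffAt]
  intro x
  exact (contDiffAt_ringInverse (𝕜 := ℝ) (φ x)).comp x hΦ.contDiffAt

/-- Derivatives of the pointwise inverse of an algebra-valued function. -/
theorem norm_iteratedFDeriv_inverse_le [CompleteSpace E] {N : ℕ → ℝ} (hN : IsLogConvexWeight N)
    {Φ H : E → E →L[ℝ] E}
    (hΦ : ContDiff ℝ ∞ Φ) (h1 : ∀ x, Φ x * H x = 1) (h2 : ∀ x, H x * Φ x = 1) (x : E)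
    {K b S : ℝ} (hK : ‖H x‖ ≤ K) (hb : 0 ≤ b) (hS : 16 * K * b * N 1 ≤ S)
    (hΦb : ∀ i, ‖iteratedFDeriv ℝ (i + 1) Φ x‖ ≤
      i.factorial * (b * S ^ i * catalan i * N (i + 1 + 1))) (k : ℕ) :
    ‖iteratedFDeriv ℝ k H x‖ ≤ k.factorial * (K / N 1 * S ^ k * catalan k * N (k + 0 + 1)) := by
  have hN1 := hN.pos 1
  have hK0 : 0 ≤ K := (norm_nonneg _).trans hK
  have hS0 : 0 ≤ S := le_trans (by positivity) hS
  have hH := contDiff_of_mul_eq_one hΦ h1 h2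
  -- T₁ composes with an operator on the left and T₂ on the right. Thus H' = -H Φ' H becomes two
  -- successive bilinear products of norm at most 1.
  let T₁ : (E →L[ℝ] E) →L[ℝ] (E →L[ℝ] E →L[ℝ] E) →L[ℝ] (E →L[ℝ] E →L[ℝ] E) :=
    (ContinuousLinearMap.compL ℝ E (E →L[ℝ] E) (E →L[ℝ] E)).comp
      (ContinuousLinearMap.compL ℝ E E E)
  let T₂ : (E →L[ℝ] E →L[ℝ] E) →L[ℝ] (E →L[ℝ] E) →L[ℝ] (E →L[ℝ] E →L[ℝ] E) :=
    ((ContinuousLinearMap.compL ℝ E (E →L[ℝ] E) (E →L[ℝ] E)).comp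
      (ContinuousLinearMap.compL ℝ E E E).flip).flip
  have hT₁ : ‖T₁‖ ≤ 1 := by
    refine (ContinuousLinearMap.opNorm_comp_le _ _).trans ?_
    exact mul_le_one₀ (ContinuousLinearMap.norm_compL_le _ _ _ _) (norm_nonneg _)
      (ContinuousLinearMap.norm_compL_le _ _ _ _)
  have hT₂ : ‖T₂‖ ≤ 1 := by
    rw [ContinuousLinearMap.opNorm_flip]
    refine (ContinuousLinearMap.opNorm_comp_le _ _).trans ?_
    refine mul_le_one₀ (ContinuousLinearMap.norm_compL_le _ _ _ _) (norm_nonneg _) ?_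
    rw [ContinuousLinearMap.opNorm_flip]
    exact ContinuousLinearMap.norm_compL_le _ _ _ _
  have hΦ' : ContDiff ℝ ∞ (fderiv ℝ Φ) := hΦ.fderiv_right (by simp)
  have hu : ContDiff ℝ ∞ fun y => T₁ (H y) (fderiv ℝ Φ y) :=
    ContDiff.clm_apply (f := fun y => T₁ (H y)) (T₁.contDiff.comp hH) hΦ'
  have hfd : fderiv ℝ H = -fun y => T₂ (T₁ (H y) (fderiv ℝ Φ y)) (H y) := by
    ext1 y
    rw [(hasFDerivAt_of_mul_eq_one (hΦ.differentiable (by simp)) h1 h2 y).fderiv]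
    ext v
    simp [T₁, T₂]
  have hconv : ∀ {c : ℝ} {i : ℕ} {t : ℝ}, t ≤ i.factorial * c → t / i.factorial ≤ c :=
    fun {c i t} h => by
      rw [div_le_iff₀ (by positivity), mul_comm]
      exact h
  have hself : ∀ (t : ℝ) (i : ℕ), t ≤ i.factorial * (t / i.factorial) := fun t i => by
    rw [mul_div_cancel₀]
    positivity
  induction k using Nat.strong_induction_on with
  | _ k ih =>
  rcases k with _ | k
  · simpa [div_mul_cancel₀ _ hN1.ne'] using hK
  rw [← norm_iteratedFDeriv_fderiv, hfd, iteratedFDeriv_neg_apply, norm_neg]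
  have step1 : ∀ i ≤ k, ‖iteratedFDeriv ℝ i (fun y => T₁ (H y) (fderiv ℝ Φ y)) x‖ ≤
      i.factorial * (4 * K * b * S ^ i * catalan i * N (i + 1 + 1)) := by
    intro i hi
    refine (norm_iteratedFDeriv_bilinear_le_antidiagonal T₁ hT₁ hH hΦ' x i
      (fun l _ => hself _ l) (fun l _ => hself _ l)).trans ?_
    gcongr
    refine (hN.sum_antidiagonal_le (k := i)
      (v := fun l => ‖iteratedFDeriv ℝ l (fderiv ℝ Φ) x‖ / l.factorial) (a := K / N 1) (b := b) (R := S) (by positivity) hb hS0 0 1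
      (fun l _ => by positivity) (fun l hl => hconv (ih l (by omega))) (fun l hl => ?_)).trans
      (le_of_eq ?_)
    · refine hconv ?_
      rw [norm_iteratedFDeriv_fderiv]
      exact hΦb l
    · rw [add_zero]
      field_simp
  refine (norm_iteratedFDeriv_bilinear_le_antidiagonal T₂ hT₂ hu hH x k
      (fun l _ => hself _ l) (fun l _ => hself _ l)).trans ?_
  have hNk := hN.pos (k + 2)
  have hcat : (catalan k : ℝ) ≤ catalan (k + 1) := by exact_mod_cast catalan_le_succ k
  -- The two Leibniz sums together produce the factor 16 K b N 1, which `hS` absorbs into one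
  -- further power of S.
  calc _ ≤ (k.factorial : ℝ) *
        (4 * (4 * K * b) * (K / N 1) * N 1 * S ^ k * catalan k * N (k + 1 + 0 + 1)) := by
        gcongr
        exact hN.sum_antidiagonal_le (k := k) (by positivity) (by positivity) hS0 1 0
          (fun l _ => by positivity) (fun l hl => hconv (step1 l hl))
          (fun l hl => hconv (ih l (by omega)))
    _ = (k.factorial : ℝ) * (K / N 1 * (16 * K * b * N 1) * S ^ k * catalan k * N (k + 2)) := by
        field_simp
        ring
    _ ≤ ((k + 1).factorial : ℝ) * (K / N 1 * S * S ^ k * catalan (k + 1) * N (k + 2)) := by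
        have hf : (k.factorial : ℝ) ≤ (k + 1).factorial := by
          exact_mod_cast Nat.factorial_le (Nat.le_succ k)
        gcongr
    _ = _ := by rw [pow_succ, add_zero]; ring

end Inverse

/-! ### Derivatives of the inverse map through an autonomous equation -/

section Inverse

open Finset

universe u

variable {E : Type u} [NormedAddCommGroup E] [NormedSpace ℝ E]

theorem sum_range_half_pow_le (n : ℕ) : ∑ j ∈ range n, (1 / 2 : ℝ) ^ j ≤ 2 := by
  rw [geom_sum_eq (by norm_num)]
  have : (0 : ℝ) ≤ (1 / 2) ^ n := by positivity
  linarith [show ((1 / 2 : ℝ) ^ n - 1) / (1 / 2 - 1) = 2 - 2 * (1 / 2) ^ n by ring]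

/-- Regularity of the solutions of the autonomous equation `g' = H ∘ g`. -/
theorem exists_bound_of_fderiv_eq_comp {N : ℕ → ℝ} (hN : IsLogConvexWeight N) {g : E → E}
    {H : E → E →L[ℝ] E} (hg : ContDiff ℝ ∞ g) (hH : ContDiff ℝ ∞ H)
    (hgH : fderiv ℝ g = H ∘ g) {D S : ℝ} (hS : 0 < S)
    (hHD : ∀ j y, ‖iteratedFDeriv ℝ j H y‖ ≤ j.factorial * (D * S ^ j * N (j + 1))) :
    ∃ A R : ℝ, 0 ≤ A ∧ 0 ≤ R ∧ ∀ k, 1 ≤ k → ∀ x,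
      ‖iteratedFDeriv ℝ k g x‖ ≤ k.factorial * (N k * (A * R ^ k * catalan k)) := by
  have hN1 := hN.pos 1
  rcases isEmpty_or_nonempty E with hE | ⟨⟨x₀⟩⟩
  · exact ⟨0, 0, le_rfl, le_rfl, fun k _ x => (hE.false x).elim⟩
  have hD : 0 ≤ D := by
    have h := (norm_nonneg _).trans (hHD 0 x₀)
    simp only [Nat.factorial_zero, Nat.cast_one, pow_zero, mul_one, one_mul, zero_add] at h
    exact nonneg_of_mul_nonneg_left h hN1
  -- This A makes 4 A N 1 S = 1/2, so the sum over j below is at most 2D. Then R is chosen with 2D =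
  -- A R, the factor that the induction needs to pass from k to k + 1.
  set A : ℝ := 1 / (8 * N 1 * S) with hA
  have hA0 : 0 < A := by positivity
  set R : ℝ := 2 * D / A with hR
  have hR0 : 0 ≤ R := by positivity
  refine ⟨A, R, hA0.le, hR0, fun k hk x => ?_⟩
  induction k using Nat.strong_induction_on with
  | _ k ih =>
  rcases k with _ | k
  · omega
  rw [← norm_iteratedFDeriv_fderiv, hgH]
  -- The shift 1 fits the weight N (j + 1) in the bound for H and yields N (k + 1), the right weight
  -- for the derivative of g of order k + 1.
  refine (norm_iteratedFDeriv_comp_le_weight hN hH hg x hA0.le hR0 k 1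
    fun i h1 h2 => ih i (by omega) h1).trans ?_
  have hNk := hN.pos (k + 1)
  have hsum : ∑ j ∈ range (k + 1), (4 * A * N 1) ^ j *
      (‖iteratedFDeriv ℝ j H (g x)‖ / (j.factorial * N (j + 1))) ≤ 2 * D := by
    calc _ ≤ ∑ j ∈ range (k + 1), (1 / 2 : ℝ) ^ j * D := by
          refine sum_le_sum fun j _ => ?_
          have hNj := hN.pos (j + 1)
          have h1 : ‖iteratedFDeriv ℝ j H (g x)‖ / (j.factorial * N (j + 1)) ≤ D * S ^ j := by
            rw [div_le_iff₀ (by positivity)]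
            refine (hHD j (g x)).trans (le_of_eq (by ring))
          calc _ ≤ (4 * A * N 1) ^ j * (D * S ^ j) := by gcongr
            _ = (4 * A * N 1 * S) ^ j * D := by rw [mul_pow _ S]; ring
            _ = _ := by
              congr 2
              rw [hA]
              field_simp
              norm_num
      _ ≤ 2 * D := by
          rw [← sum_mul]
          gcongr
          exact sum_range_half_pow_le _
  have hcat : (catalan k : ℝ) ≤ catalan (k + 1) := by exact_mod_cast catalan_le_succ k
  have hf : (k.factorial : ℝ) ≤ (k + 1).factorial := by
    exact_mod_cast Nat.factorial_le (Nat.le_succ k)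
  refine (mul_le_mul_of_nonneg_left hsum (by positivity)).trans ?_
  calc _ ≤ ((k + 1).factorial : ℝ) * (N (k + 1) * (R ^ k * catalan (k + 1))) * (2 * D) := by
        gcongr
    _ = ((k + 1).factorial : ℝ) * (N (k + 1) * (R ^ k * catalan (k + 1))) * (A * R) := by
        rw [hR]
        field_simp
    _ = _ := by ring

/-- The inverse of a mapping whose derivatives are bounded by a log-convex sequence has its
derivatives bounded by the same sequence. -/
theorem exists_bound_of_rightInverse [CompleteSpace E] {N : ℕ → ℝ} (hN : IsLogConvexWeight N)
    {F G : E → E} (hF : ContDiff ℝ ∞ F) (hG : ContDiff ℝ ∞ G) (hFG : ∀ x, F (G x) = x)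
    {H : E → E →L[ℝ] E} (h1 : ∀ x, fderiv ℝ F x * H x = 1) (h2 : ∀ x, H x * fderiv ℝ F x = 1)
    {K C ρ : ℝ} (hHK : ∀ x, ‖H x‖ ≤ K) (hC : 0 ≤ C) (hρ : 0 < ρ)
    (hFC : ∀ k, 1 ≤ k → ∀ x, ‖iteratedFDeriv ℝ k F x‖ ≤ k.factorial * (C * ρ ^ k * N k)) :
    ∃ C' ρ' : ℝ, 0 ≤ C' ∧ 0 ≤ ρ' ∧ ∀ k, 1 ≤ k → ∀ x,
      ‖iteratedFDeriv ℝ k G x‖ ≤ k.factorial * (C' * ρ' ^ k * N k) := by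
  have hN1 := hN.pos 1
  rcases isEmpty_or_nonempty E with hE | ⟨⟨x₀⟩⟩
  · exact ⟨0, 0, le_rfl, le_rfl, fun k _ x => (hE.false x).elim⟩
  have hK : 0 ≤ K := (norm_nonneg _).trans (hHK x₀)
  have hF' : ContDiff ℝ ∞ (fderiv ℝ F) := hF.fderiv_right (by simp)
  -- The derivative of F' of order i + 1 is that of F of order i + 2, and (i+2)! = (i+2)(i+1) i!
  -- with (i+2)(i+1) ≤ 2 · 4^i. This explains 2Cρ² and 4ρ; the other entry of the maximum is
  -- required by `norm_iteratedFDeriv_inverse_le`.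
  set b : ℝ := 2 * C * ρ ^ 2 with hb
  set S : ℝ := max (16 * K * b * N 1) (4 * ρ) with hS
  have hS0 : 0 < S := lt_of_lt_of_le (by positivity) (le_max_right _ _)
  have hquad : ∀ i : ℕ, ((i : ℝ) + 2) * (i + 1) ≤ 2 * 4 ^ i := fun i => by
    induction i with
    | zero => norm_num
    | succ i ih =>
      rw [pow_succ]
      push_cast
      nlinarith
  have hHb : ∀ j y, ‖iteratedFDeriv ℝ j H y‖ ≤
      j.factorial * (K / N 1 * (4 * S) ^ j * N (j + 1)) := by
    intro j y
    refine (norm_iteratedFDeriv_inverse_le hN hF' h1 h2 y (hHK y) (b := b) (S := S)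
      (by positivity) (le_max_left _ _) (fun i => ?_) j).trans ?_
    · rw [norm_iteratedFDeriv_fderiv]
      have p := hN.pos (i + 2)
      have hcat : (1 : ℝ) ≤ catalan i := by exact_mod_cast one_le_catalan i
      calc ‖iteratedFDeriv ℝ (i + 2) F y‖
          ≤ (i + 2).factorial * (C * ρ ^ (i + 2) * N (i + 2)) := hFC _ (by omega) y
        _ = i.factorial * (((i : ℝ) + 2) * (i + 1)) * (C * ρ ^ (i + 2) * N (i + 2)) := by
            rw [Nat.factorial_succ, Nat.factorial_succ]
            push_cast
            ring
        _ ≤ i.factorial * (2 * 4 ^ i) * (C * ρ ^ (i + 2) * N (i + 2)) := by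
            exact mul_le_mul_of_nonneg_right
              (mul_le_mul_of_nonneg_left (hquad i) (by positivity)) (by positivity)
        _ = i.factorial * (b * (4 * ρ) ^ i * 1 * N (i + 2)) := by
            rw [hb, mul_pow, pow_add]; ring
        _ ≤ i.factorial * (b * S ^ i * catalan i * N (i + 2)) := by
            gcongr
            exact le_max_right _ _
    · have p := hN.pos (j + 1)
      have hcat : (catalan j : ℝ) ≤ 4 ^ j := by exact_mod_cast catalan_le_four_pow j
      calc _ ≤ (j.factorial : ℝ) * (K / N 1 * S ^ j * 4 ^ j * N (j + 1)) := by gcongr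
        _ = _ := by rw [mul_pow]; ring
  have hH := contDiff_of_mul_eq_one hF' h1 h2
  have hGH : fderiv ℝ G = H ∘ G := by
    ext1 x
    have h3 : fderiv ℝ (F ∘ G) x = 1 := by
      rw [show F ∘ G = id from funext hFG, fderiv_id]
      rfl
    rw [fderiv_comp _ (hF.differentiable (by simp) _) (hG.differentiable (by simp) _)] at h3
    have h4 : fderiv ℝ F (G x) * fderiv ℝ G x = 1 := h3
    calc fderiv ℝ G x = H (G x) * fderiv ℝ F (G x) * fderiv ℝ G x := by rw [h2, one_mul]
      _ = H (G x) := by rw [mul_assoc, h4, mul_one]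
  obtain ⟨A, R, hA, hR, h⟩ :=
    exists_bound_of_fderiv_eq_comp hN hG hH hGH (S := 4 * S) (by positivity) hHb
  refine ⟨A, 4 * R, hA, by positivity, fun k hk x => (h k hk x).trans ?_⟩
  have p := hN.pos k
  have hcat : (catalan k : ℝ) ≤ 4 ^ k := by exact_mod_cast catalan_le_four_pow k
  calc _ ≤ (k.factorial : ℝ) * (N k * (A * R ^ k * 4 ^ k)) := by gcongr
    _ = _ := by rw [mul_pow]; ring

end Inverse

/-! ### Reduction of the Beurling case to the Roumieu case -/

section Reduction

open Finset Filter Topology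

theorem IsWeightSequence.one_le {t : ClassType} {M : ℕ → ℝ} (hM : IsWeightSequence t M) (k : ℕ) :
    1 ≤ M k := hM.zero ▸ hM.mono (Nat.zero_le k)

theorem IsWeightSequence.isLogConvexWeight {t : ClassType} {M : ℕ → ℝ}
    (hM : IsWeightSequence t M) : IsLogConvexWeight M :=
  ⟨hM.zero, fun k => zero_lt_one.trans_le (hM.one_le k), hM.logConvex⟩

theorem IsLogConvexWeight.monotone_ratio {M : ℕ → ℝ} (hM : IsLogConvexWeight M) :
    Monotone fun k => M (k + 1) / M k := by
  refine monotone_nat_of_le_succ fun k => ?_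
  rw [div_le_div_iff₀ (hM.pos _) (hM.pos _)]
  linarith [hM.logConvex k, sq (M (k + 1))]

/-- If the increasing ratios stayed below b, then M k ≤ b^k and the k-th roots would be bounded. -/
theorem IsLogConvexWeight.tendsto_ratio {M : ℕ → ℝ} (hM : IsLogConvexWeight M)
    (h : Tendsto (fun k : ℕ => M k ^ (1 / (k : ℝ))) atTop atTop) :
    Tendsto (fun k => M (k + 1) / M k) atTop atTop := by
  refine tendsto_atTop_atTop_of_monotone hM.monotone_ratio fun b => ?_
  by_contra! hb
  have hb0 : 0 < b := (div_pos (hM.pos _) (hM.pos _)).trans (hb 0)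
  have hle : ∀ k, M k ≤ b ^ k := fun k => by
    induction k with
    | zero => simp [hM.zero]
    | succ k ih =>
      have h1 := (div_lt_iff₀ (hM.pos k)).1 (hb k)
      calc M (k + 1) ≤ b * M k := h1.le
        _ ≤ b * b ^ k := by gcongr
        _ = b ^ (k + 1) := by ring
  obtain ⟨k, hk1, hk2⟩ := ((h.eventually_gt_atTop b).and (eventually_ge_atTop 1)).exists
  have : M k ^ (1 / (k : ℝ)) ≤ b := by
    rw [one_div]
    refine (Real.rpow_le_rpow (hM.pos k).le (hle k) (by positivity)).trans (le_of_eq ?_)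
    exact Real.pow_rpow_inv_natCast hb0.le (by omega)
  linarith

/-- A sequence decaying faster than every geometric sequence is eventually dominated by the powers
of a positive null sequence which is decreasing. -/
theorem exists_antitone_null_of_geometric {v : ℕ → ℝ} (hv0 : ∀ k, 0 ≤ v k)
    (hv : ∀ ρ : ℝ, 0 < ρ → ∃ C : ℝ, ∀ k, 1 ≤ k → v k ≤ C * ρ ^ k) :
    ∃ ε : ℕ → ℝ, Antitone ε ∧ (∀ k, 0 < ε k) ∧ Tendsto ε atTop (𝓝 0) ∧
      ∀ k, 1 ≤ k → v k ≤ ε k ^ k := by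
  -- The sequence sought is the supremum of e over the tail from k on; the term 1/(j+1) keeps it
  -- positive.
  set e : ℕ → ℝ := fun j => max (1 / ((j : ℝ) + 1)) (v j ^ (1 / (j : ℝ))) with he
  have hsmall : ∀ ρ : ℝ, 0 < ρ → ∀ᶠ j : ℕ in atTop, e j ≤ ρ := by
    intro ρ hρ
    obtain ⟨C, hC⟩ := hv (ρ / 2) (by positivity)
    have h1 : ∀ᶠ j : ℕ in atTop, C ≤ 2 ^ j :=
      (tendsto_pow_atTop_atTop_of_one_lt (by norm_num : (1 : ℝ) < 2)).eventually_ge_atTop C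
    have h2 : ∀ᶠ j : ℕ in atTop, 1 / ((j : ℝ) + 1) ≤ ρ :=
      (tendsto_one_div_add_atTop_nhds_zero_nat (𝕜 := ℝ)).eventually_le_const hρ
    filter_upwards [h1, h2, eventually_ge_atTop 1] with j hj1 hj2 hj3
    refine max_le hj2 ?_
    have h3 : v j ≤ ρ ^ j := by
      calc v j ≤ C * (ρ / 2) ^ j := hC j hj3
        _ ≤ 2 ^ j * (ρ / 2) ^ j := by gcongr
        _ = ρ ^ j := by rw [← mul_pow]; congr 1; ring
    rw [one_div]
    refine (Real.rpow_le_rpow (hv0 j) h3 (by positivity)).trans (le_of_eq ?_)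
    exact Real.pow_rpow_inv_natCast hρ.le (by omega)
  have he0 : ∀ j, 0 < e j := fun j => lt_max_of_lt_left (by positivity)
  have hbdd : BddAbove (Set.range e) := by
    obtain ⟨J, hJ⟩ := eventually_atTop.1 (hsmall 1 one_pos)
    refine ⟨(∑ j ∈ range J, e j) + 1, ?_⟩
    rintro _ ⟨j, rfl⟩
    have hs : 0 ≤ ∑ j ∈ range J, e j := sum_nonneg fun j _ => (he0 j).le
    rcases lt_or_ge j J with h | h
    · have := single_le_sum (fun i _ => (he0 i).le) (mem_range.2 h)
      linarith
    · linarith [hJ j h]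
  have hbdd' : ∀ k, BddAbove (Set.range fun j => e (k + j)) := fun k =>
    hbdd.mono (by rintro _ ⟨j, rfl⟩; exact ⟨_, rfl⟩)
  have hle : ∀ k, e k ≤ ⨆ j, e (k + j) := fun k => le_ciSup (hbdd' k) 0
  refine ⟨fun k => ⨆ j, e (k + j), ?_, fun k => (he0 k).trans_le (hle k), ?_, ?_⟩
  · intro k l hkl
    refine ciSup_le fun j => ?_
    have := le_ciSup (hbdd' k) (l - k + j)
    rwa [show k + (l - k + j) = l + j by omega] at this
  · rw [Metric.tendsto_atTop]
    intro r hr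
    obtain ⟨J, hJ⟩ := eventually_atTop.1 (hsmall (r / 2) (by positivity))
    refine ⟨J, fun k hk => ?_⟩
    rw [Real.dist_eq, sub_zero, abs_of_pos ((he0 k).trans_le (hle k))]
    have : ⨆ j, e (k + j) ≤ r / 2 := ciSup_le fun j => hJ _ (by omega)
    linarith
  · intro k hk
    calc v k = (v k ^ (1 / (k : ℝ))) ^ k := by
          rw [one_div, Real.rpow_inv_natCast_pow (hv0 k) (by omega)]
      _ ≤ (⨆ j, e (k + j)) ^ k := by
          have := Real.rpow_nonneg (hv0 k) (1 / (k : ℝ))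
          gcongr
          exact (le_max_right _ _).trans (hle k)

/-- A Beurling-type bound with respect to `M` is a Roumieu-type bound with respect to some
log-convex sequence which is much smaller than `M`. -/
theorem exists_isLogConvexWeight_of_beurling {M : ℕ → ℝ} (hM : IsLogConvexWeight M)
    (hMtop : Tendsto (fun k : ℕ => M k ^ (1 / (k : ℝ))) atTop atTop) {u : ℕ → ℝ}
    (hu0 : ∀ k, 0 ≤ u k)
    (hu : ∀ ρ : ℝ, 0 < ρ → ∃ C : ℝ, ∀ k, 1 ≤ k → u k ≤ C * (ρ ^ k * M k)) :
    ∃ N : ℕ → ℝ, IsLogConvexWeight N ∧ (∀ k, 1 ≤ k → u k ≤ N k) ∧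
      ∀ ρ : ℝ, 0 < ρ → ∃ C : ℝ, ∀ k, N k ≤ C * (ρ ^ k * M k) := by
  obtain ⟨ε, hanti, hpos, hnull, hε⟩ := exists_antitone_null_of_geometric
    (v := fun k => u k / M k) (fun k => div_nonneg (hu0 k) (hM.pos k).le) (fun ρ hρ => by
      obtain ⟨C, hC⟩ := hu ρ hρ
      refine ⟨C, fun k hk => ?_⟩
      rw [div_le_iff₀ (hM.pos k)]
      exact (hC k hk).trans (le_of_eq (by ring)))
  set m : ℕ → ℝ := fun k => M (k + 1) / M k with hm
  have hm0 : ∀ k, 0 < m k := fun k => div_pos (hM.pos _) (hM.pos _)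
  have hmm : Monotone m := hM.monotone_ratio
  have hmtop : Tendsto m atTop atTop := hM.tendsto_ratio hMtop
  have hMm : ∀ k, M (k + 1) = m k * M k := fun k => by
    rw [hm]
    exact (div_mul_cancel₀ _ (hM.pos k).ne').symm
  -- The product of the m i is M. Each factor is shrunk by ε, and the running maximum n restores
  -- monotonicity, so the products N of the n i are log-convex.
  set a : ℕ → ℝ := fun k => ε (k + 1) * m k with ha
  set n : ℕ →o ℝ := partialSups a with hn
  have han : ∀ k, a k ≤ n k := fun k => le_partialSups a k
  have hn0 : ∀ k, 0 < n k := fun k => (mul_pos (hpos _) (hm0 k)).trans_le (han k)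
  have hsmall : ∀ ρ : ℝ, 0 < ρ → ∃ I, ∀ i ≥ I, n i ≤ ρ * m i := by
    intro ρ hρ
    obtain ⟨J, hJ⟩ := eventually_atTop.1 (hnull.eventually_le_const hρ)
    obtain ⟨I, hI⟩ := eventually_atTop.1 (hmtop.eventually_ge_atTop (n J / ρ))
    refine ⟨I, fun i hi => partialSups_le _ _ _ fun j hj => ?_⟩
    -- Early terms are at most n J, which is negligible because m tends to infinity; in late terms ε
    -- is already at most ρ.
    rcases le_total j J with h | h
    · have h1 := hI i hi
      rw [div_le_iff₀ hρ] at h1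
      have h2 := (han j).trans (n.monotone h)
      linarith
    · have h1 := hJ (j + 1) (by omega)
      have h2 := hmm hj
      have h3 := hm0 j
      calc ε (j + 1) * m j ≤ ρ * m j := by gcongr
        _ ≤ ρ * m i := by gcongr
  set N : ℕ → ℝ := fun k => ∏ i ∈ range k, n i with hN
  have hN0 : ∀ k, 0 < N k := fun k => prod_pos fun i _ => hn0 i
  have hNs : ∀ k, N (k + 1) = N k * n k := fun k => prod_range_succ _ _
  refine ⟨N, ⟨by simp [hN], hN0, fun k => ?_⟩, fun k hk => ?_, fun ρ hρ => ?_⟩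
  · rw [sq, hNs (k + 1)]
    nth_rewrite 1 [hNs k]
    have h1 := n.monotone (Nat.le_succ k)
    have h2 := hN0 k
    have h3 := hN0 (k + 1)
    calc N k * n k * N (k + 1) ≤ N k * n (k + 1) * N (k + 1) := by gcongr
      _ = _ := by ring
  -- For i < k one has ε k ≤ ε (i+1), so ε k times m i is at most n i, factor by factor.
  · have h1 : ∀ l ≤ k, ε k ^ l * M l ≤ N l := fun l hl => by
      induction l with
      | zero => simp [hN, hM.zero]
      | succ l ih =>
        have h2 := ih (by omega)
        have h3 : ε k ≤ ε (l + 1) := hanti hl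
        have h4 := hpos k
        have h5 := hm0 l
        have h6 := hM.pos l
        rw [hNs, hMm]
        calc ε k ^ (l + 1) * (m l * M l) = (ε k ^ l * M l) * (ε k * m l) := by ring
          _ ≤ N l * n l := by
            refine mul_le_mul h2 (le_trans ?_ (han l)) (by positivity) (hN0 l).le
            exact mul_le_mul_of_nonneg_right h3 h5.le
    have h2 := hε k hk
    rw [div_le_iff₀ (hM.pos k)] at h2
    exact h2.trans (h1 k le_rfl)
  · obtain ⟨I, hI⟩ := hsmall ρ hρ
    have hp : ∀ k, 0 < ρ ^ k * M k := fun k => mul_pos (pow_pos hρ k) (hM.pos k)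
    have hq : ∀ k, 0 ≤ N k / (ρ ^ k * M k) := fun k => (div_pos (hN0 k) (hp k)).le
    set C := ∑ k ∈ range (I + 1), N k / (ρ ^ k * M k) with hC
    have hC0 : 0 ≤ C := sum_nonneg fun k _ => hq k
    have hlow : ∀ k ≤ I, N k ≤ C * (ρ ^ k * M k) := fun k hk => by
      rw [← div_le_iff₀ (hp k)]
      exact single_le_sum (f := fun k => N k / (ρ ^ k * M k)) (fun k _ => hq k)
        (mem_range.2 (by omega))
    refine ⟨C, fun k => ?_⟩
    induction k with
    | zero => exact hlow 0 (Nat.zero_le _)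
    | succ k ih =>
      rcases le_or_gt (k + 1) I with h | h
      · exact hlow _ h
      · have h1 := hI k (by omega)
        rw [hNs, hMm, pow_succ]
        calc N k * n k ≤ (C * (ρ ^ k * M k)) * (ρ * m k) :=
              mul_le_mul ih h1 (hn0 k).le (mul_nonneg hC0 (hp k).le)
          _ = _ := by ring

universe u

/-- The inverse of a mapping with globally `[M]`-bounded derivatives of positive order has
globally `[M]`-bounded derivatives of positive order. -/
theorem box_bound_of_rightInverse {E : Type u} [NormedAddCommGroup E] [NormedSpace ℝ E]
    [CompleteSpace E] {t : ClassType} {M : ℕ → ℝ} (hM : IsWeightSequence t M)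
    {F G : E → E} (hF : ContDiff ℝ ∞ F) (hG : ContDiff ℝ ∞ G) (hFG : ∀ x, F (G x) = x)
    {H : E → E →L[ℝ] E} (h1 : ∀ x, fderiv ℝ F x * H x = 1) (h2 : ∀ x, H x * fderiv ℝ F x = 1)
    {K : ℝ} (hHK : ∀ x, ‖H x‖ ≤ K)
    (hFC : Box t fun ρ => ∃ C : ℝ, ∀ k, 1 ≤ k → ∀ x,
      ‖iteratedFDeriv ℝ k F x‖ ≤ C * (ρ ^ k * (k.factorial : ℝ) * M k)) :
    Box t fun ρ => ∃ C : ℝ, ∀ k, 1 ≤ k → ∀ x,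
      ‖iteratedFDeriv ℝ k G x‖ ≤ C * (ρ ^ k * (k.factorial : ℝ) * M k) := by
  have hMw := hM.isLogConvexWeight
  cases t with
  | roumieu =>
    obtain ⟨ρ, hρ, C, hC⟩ := hFC
    obtain ⟨C', ρ', hC'0, hρ'0, h⟩ := exists_bound_of_rightInverse hMw hF hG hFG h1 h2 hHK
      (le_max_right C 0) hρ fun k hk x => by
        have p := hMw.pos k
        calc _ ≤ C * (ρ ^ k * (k.factorial : ℝ) * M k) := hC k hk x
          _ ≤ max C 0 * (ρ ^ k * (k.factorial : ℝ) * M k) := by gcongr; exact le_max_left _ _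
          _ = _ := by ring
    refine ⟨ρ' + 1, by positivity, C', fun k hk x => (h k hk x).trans ?_⟩
    have p := hMw.pos k
    calc _ ≤ (k.factorial : ℝ) * (C' * (ρ' + 1) ^ k * M k) := by gcongr; linarith
      _ = _ := by ring
  | beurling =>
    rcases isEmpty_or_nonempty E with hE | hE
    · exact fun ρ _ => ⟨0, fun k _ x => (hE.false x).elim⟩
    have hFC' : ∀ ρ : ℝ, 0 < ρ → ∃ C : ℝ, ∀ k, 1 ≤ k → ∀ x,
      ‖iteratedFDeriv ℝ k F x‖ ≤ C * (ρ ^ k * (k.factorial : ℝ) * M k) := hFC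
    have hbdd : ∀ k, 1 ≤ k → BddAbove (Set.range fun x => ‖iteratedFDeriv ℝ k F x‖) := by
      intro k hk
      obtain ⟨C, hC⟩ := hFC' 1 one_pos
      exact ⟨_, by rintro _ ⟨x, rfl⟩; exact hC k hk x⟩
    -- Suprema over x give a single sequence, so one N serves every ρ. The radius ρ' obtained for N
    -- is independent of ρ and is cancelled by using N k ≤ C (ρ/(ρ'+1))^k M k.
    obtain ⟨N, hN, huN, hNM⟩ := exists_isLogConvexWeight_of_beurling hMw (hM.beurling rfl)
      (u := fun k => (⨆ x, ‖iteratedFDeriv ℝ k F x‖) / k.factorial)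
      (fun k => div_nonneg (Real.iSup_nonneg fun x => norm_nonneg _) (by positivity))
      (fun ρ hρ => by
        obtain ⟨C, hC⟩ := hFC' ρ hρ
        refine ⟨C, fun k hk => ?_⟩
        rw [div_le_iff₀ (by positivity)]
        refine (ciSup_le (hC k hk)).trans (le_of_eq (by ring)))
    obtain ⟨C', ρ', hC'0, hρ'0, h⟩ := exists_bound_of_rightInverse hN hF hG hFG h1 h2 hHK
      zero_le_one one_pos fun k hk x => by
        have h3 := huN k hk
        rw [div_le_iff₀ (by positivity)] at h3
        refine (le_ciSup (hbdd k hk) x).trans (h3.trans (le_of_eq (by ring)))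
    intro ρ hρ
    obtain ⟨C, hC⟩ := hNM (ρ / (ρ' + 1)) (by positivity)
    refine ⟨C' * C, fun k hk x => (h k hk x).trans ?_⟩
    have p := hN.pos k
    calc _ ≤ (k.factorial : ℝ) * (C' * (ρ' + 1) ^ k * N k) := by gcongr; linarith
      _ ≤ (k.factorial : ℝ) * (C' * (ρ' + 1) ^ k * (C * ((ρ / (ρ' + 1)) ^ k * M k))) := by
        gcongr
        exact hC k
      _ = _ := by
        rw [div_pow]
        field_simp

end Reduction

/-! ### Global inversion of proper local diffeomorphisms -/

section Hadamard

open Filter Topology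

variable {E : Type*} [NormedAddCommGroup E] [NormedSpace ℝ E] [FiniteDimensional ℝ E]

theorem isUnit_of_det_ne_zero {T : E →L[ℝ] E} (hT : T.det ≠ 0) : IsUnit T := by
  let e := T.toContinuousLinearEquivOfDetNeZero hT
  refine ⟨⟨T, e.symm, ?_, ?_⟩, rfl⟩
  · ext x
    exact e.apply_symm_apply x
  · ext x
    exact e.symm_apply_apply x

/-- In finite dimension these operators form a compact set of invertible ones, on which inversion is
continuous. -/
theorem exists_norm_inverse_le (C : ℝ) {c : ℝ} (hc : 0 < c) :
    ∃ K : ℝ, ∀ T : E →L[ℝ] E, ‖T‖ ≤ C → c ≤ T.det → ‖Ring.inverse T‖ ≤ K := by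
  have : ProperSpace (E →L[ℝ] E) := FiniteDimensional.proper ℝ _
  have hcomp : IsCompact (Metric.closedBall (0 : E →L[ℝ] E) C ∩ {T | c ≤ T.det}) :=
    (isCompact_closedBall _ _).inter_right
      (isClosed_le continuous_const ContinuousLinearMap.continuous_det)
  have hcont : ContinuousOn (Ring.inverse : (E →L[ℝ] E) → _)
      (Metric.closedBall (0 : E →L[ℝ] E) C ∩ {T | c ≤ T.det}) := by
    rintro T ⟨-, hT⟩
    obtain ⟨u, rfl⟩ := isUnit_of_det_ne_zero (hc.trans_le hT).ne'
    have : CompleteSpace E := FiniteDimensional.complete ℝ E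
    exact (NormedRing.inverse_continuousAt u).continuousWithinAt
  obtain ⟨K, hK⟩ := hcomp.exists_bound_of_continuousOn hcont
  exact ⟨K, fun T h1 h2 => hK T ⟨by simpa using h1, h2⟩⟩

/-- Hadamard's global inverse function theorem for smooth proper maps. -/
theorem exists_smooth_inverse {F : E → E} (hF : ContDiff ℝ ∞ F)
    (hproper : Tendsto F (cocompact E) (cocompact E)) (hdet : ∀ x, (fderiv ℝ F x).det ≠ 0) :
    ∃ G : E → E, ContDiff ℝ ∞ G ∧ (∀ x, F (G x) = x) ∧ ∀ x, G (F x) = x := by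
  have : CompleteSpace E := FiniteDimensional.complete ℝ E
  have hloc : ∀ x, ∃ φ : OpenPartialHomeomorph E E, x ∈ φ.source ∧ φ = F ∧
      ContDiffAt ℝ ∞ φ.symm (F x) := by
    intro x
    let e := (fderiv ℝ F x).toContinuousLinearEquivOfDetNeZero (hdet x)
    have he : HasFDerivAt F (e : E →L[ℝ] E) x := (hF.differentiable (by simp) x).hasFDerivAt
    refine ⟨hF.contDiffAt.toOpenPartialHomeomorph F he (by simp),
      hF.contDiffAt.mem_toOpenPartialHomeomorph_source he (by simp), rfl, ?_⟩
    exact hF.contDiffAt.to_localInverse he (by simp)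
  have hlh : IsLocalHomeomorph F := fun x => by
    obtain ⟨φ, h1, h2, -⟩ := hloc x
    exact ⟨φ, h1, h2.symm⟩
  have hprop : IsProperMap F := isProperMap_iff_tendsto_cocompact.2 ⟨hF.continuous, hproper⟩
  have hfin : ∀ y : E, (F ⁻¹' {y}).Finite := fun y => by
    refine (hprop.isCompact_preimage isCompact_singleton).finite
      (IsDiscrete.of_openPartialHomeomorph F subset_rfl fun x _ => ?_)
    obtain ⟨φ, h1, h2, -⟩ := hloc x
    exact ⟨φ, h1, h2⟩
  -- A closed local homeomorphism with finite fibres is a covering. The identity of E lifts through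
  -- it to a section G, and uniqueness of lifts gives G ∘ F = id.
  have hcov : IsCoveringMap F := isCoveringMap_iff_isCoveringMapOn_univ.2
    (hprop.isClosedMap.isCoveringMapOn_of_isLocalHomeomorphOn (fun y _ => hfin y)
      (by simpa [← isLocalHomeomorph_iff_isLocalHomeomorphOn_univ] using hlh))
  obtain ⟨G, ⟨hG0, hFG⟩, -⟩ := hcov.existsUnique_continuousMap_lifts
    (ContinuousMap.id E) (F 0) 0 rfl
  have hFG' : ∀ x, F (G x) = x := fun x => congrFun hFG x
  have hGF : G ∘ F = id := hcov.eq_of_comp_eq (G.continuous.comp hF.continuous) continuous_id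
    (funext fun x => hFG' (F x)) 0 hG0
  refine ⟨G, contDiff_iff_contDiffAt.2 fun y => ?_, hFG', fun x => congrFun hGF x⟩
  obtain ⟨φ, h1, h2, h3⟩ := hloc (G y)
  rw [hFG'] at h3
  refine h3.congr_of_eventuallyEq ?_
  have hy : y ∈ φ.target := by
    have := φ.map_source h1
    rwa [h2, hFG'] at this
  filter_upwards [φ.open_target.mem_nhds hy] with z hz
  -- Applying G to this identity shows that G agrees near y with the smooth local inverse.
  have h4 : F (φ.symm z) = z := by
    rw [← h2]
    exact φ.right_inv hz
  conv_lhs => rw [← h4]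
  exact congrFun hGF _

theorem tendsto_cocompact_id_add {f : E → E} {B : ℝ} (hf : ∀ x, ‖f x‖ ≤ B) :
    Tendsto (fun x => x + f x) (cocompact E) (cocompact E) := by
  have : ProperSpace E := FiniteDimensional.proper ℝ E
  refine tendsto_cocompact_of_tendsto_dist_comp_atTop 0 ?_
  simp only [dist_zero_right]
  refine tendsto_atTop_mono (f := fun x => ‖x‖ + -B) (fun x => ?_)
    (tendsto_atTop_add_const_right _ _ tendsto_norm_cocompact_atTop)
  have h := norm_sub_le (x + f x) (f x)
  rw [add_sub_cancel_right] at h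
  linarith [hf x]

end Hadamard

/-! ### Radius bookkeeping and composition in 𝓑 and 𝓢 -/

section Classes

open Finset

theorem Box.imp {t : ClassType} {P Q : ℝ → Prop} (h : ∀ ρ, 0 < ρ → P ρ → Q ρ) (hP : Box t P) :
    Box t Q := by
  cases t with
  | beurling => exact fun ρ hρ => h ρ hρ (hP ρ hρ)
  | roumieu =>
    obtain ⟨ρ, hρ, hp⟩ := hP
    exact ⟨ρ, hρ, h ρ hρ hp⟩

theorem Box.of_forall {t : ClassType} {P : ℝ → Prop} (h : ∀ ρ, 0 < ρ → P ρ) : Box t P := by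
  cases t with
  | beurling => exact h
  | roumieu => exact ⟨1, one_pos, h 1 one_pos⟩

theorem Box.exists {t : ClassType} {P : ℝ → Prop} (h : Box t P) : ∃ ρ, 0 < ρ ∧ P ρ := by
  cases t with
  | beurling => exact ⟨1, one_pos, h 1 one_pos⟩
  | roumieu => exact h

/-- Here ρ is the radius of the inner map, b a constant depending on it, and σ the radius of the
outer map. In the Beurling case ρ = r/8 is chosen first, which fixes b, and then σ with bσ ≤ min 1
r, so that 4ρ(1 + bσ) ≤ r. The condition bσ ≤ r serves the polynomial weights in `MemS.comp`. -/
theorem Box.comp {t : ClassType} {P Q S : ℝ → Prop}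
    (h : ∀ ρ, 0 < ρ → P ρ → ∃ b : ℝ, 0 ≤ b ∧ ∀ σ, 0 < σ → Q σ → ∀ r, 0 < r → b * σ ≤ r →
      4 * ρ * (1 + b * σ) ≤ r → S r) (hP : Box t P) (hQ : Box t Q) : Box t S := by
  cases t with
  | beurling =>
    intro r hr
    obtain ⟨b, hb, h'⟩ := h (r / 8) (by positivity) (hP _ (by positivity))
    have hσ : 0 < min 1 r / (b + 1) := by positivity
    have h1 : b * (min 1 r / (b + 1)) ≤ min 1 r := by
      rw [← mul_div_assoc, div_le_iff₀ (by positivity)]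
      have : 0 < min 1 r := by positivity
      nlinarith
    have h2 := h1.trans (min_le_left _ _)
    exact h' _ hσ (hQ _ hσ) r hr (h1.trans (min_le_right _ _)) (by nlinarith)
  | roumieu =>
    obtain ⟨ρ, hρ, hp⟩ := hP
    obtain ⟨σ, hσ, hq⟩ := hQ
    obtain ⟨b, hb, h'⟩ := h ρ hρ hp
    have h1 : 0 < 4 * ρ * (1 + b * σ) := by positivity
    exact ⟨max (b * σ) (4 * ρ * (1 + b * σ)), lt_max_of_lt_right h1,
      h' σ hσ hq _ (lt_max_of_lt_right h1) (le_max_left _ _) (le_max_right _ _)⟩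

theorem Box.and {t : ClassType} {P Q S : ℝ → Prop} (hmono : ∀ ρ σ, 0 < ρ → ρ ≤ σ → P ρ → P σ)
    (hmono' : ∀ ρ σ, 0 < ρ → ρ ≤ σ → Q ρ → Q σ) (h : ∀ ρ, 0 < ρ → P ρ → Q ρ → S ρ)
    (hP : Box t P) (hQ : Box t Q) : Box t S := by
  cases t with
  | beurling => exact fun ρ hρ => h ρ hρ (hP ρ hρ) (hQ ρ hρ)
  | roumieu =>
    obtain ⟨ρ, hρ, hp⟩ := hP
    obtain ⟨σ, hσ, hq⟩ := hQ
    exact ⟨max ρ σ, lt_max_of_lt_left hρ, h _ (lt_max_of_lt_left hρ)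
      (hmono _ _ hρ (le_max_left _ _) hp) (hmono' _ _ hσ (le_max_right _ _) hq)⟩

theorem sum_range_pow_le_one_add_pow {a : ℝ} (ha : 0 ≤ a) (k : ℕ) :
    ∑ j ∈ range (k + 1), a ^ j ≤ (1 + a) ^ k := by
  rw [add_comm 1 a, add_pow]
  refine sum_le_sum fun j hj => ?_
  have h : (1 : ℝ) ≤ k.choose j := by
    exact_mod_cast Nat.choose_pos (Nat.lt_succ_iff.1 (mem_range.1 hj))
  rw [one_pow, mul_one]
  exact le_mul_of_one_le_right (by positivity) h

universe u

variable {E F : Type u} [NormedAddCommGroup E] [NormedSpace ℝ E]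
  [NormedAddCommGroup F] [NormedSpace ℝ F]

/-- The derivatives of positive order satisfy global `[M]`-estimates. -/
def HasBoundedDerivs (t : ClassType) (M : ℕ → ℝ) (g : E → F) : Prop :=
  Box t fun ρ => ∃ C : ℝ, ∀ k, 1 ≤ k → ∀ x,
    ‖iteratedFDeriv ℝ k g x‖ ≤ C * (ρ ^ k * (k.factorial : ℝ) * M k)

/-- B is independent of f and the bound is pointwise, so uniform, weighted and L^p estimates for f
can all be inserted. The 4 in 4ρ comes from C_k ≤ 4^k. -/
theorem exists_norm_iteratedFDeriv_comp_le {M : ℕ → ℝ} (hM : IsLogConvexWeight M) {g : E → E}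
    (hg : ContDiff ℝ ∞ g) {ρ : ℝ} (hρ : 0 < ρ)
    (h : ∃ C : ℝ, ∀ k, 1 ≤ k → ∀ x,
      ‖iteratedFDeriv ℝ k g x‖ ≤ C * (ρ ^ k * (k.factorial : ℝ) * M k)) :
    ∃ B : ℝ, 0 ≤ B ∧ ∀ f : E → F, ContDiff ℝ ∞ f → ∀ k x,
      ‖iteratedFDeriv ℝ k (f ∘ g) x‖ ≤ k.factorial * M k * (4 * ρ) ^ k *
        ∑ j ∈ range (k + 1), B ^ j * (‖iteratedFDeriv ℝ j f (g x)‖ / (j.factorial * M j)) := by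
  obtain ⟨C, hC⟩ := h
  have hM0 := fun k => (hM.pos k).le
  have hM1 := hM0 1
  have hC0 := le_max_right C 0
  refine ⟨4 * max C 0 * M 1, by positivity, fun f hf k x => ?_⟩
  refine (norm_iteratedFDeriv_comp_le_weight hM hf hg x hC0 hρ.le k 0 fun i hi _ => ?_).trans ?_
  · have hcat : (1 : ℝ) ≤ catalan i := by exact_mod_cast one_le_catalan i
    have p := hM0 i
    calc _ ≤ C * (ρ ^ i * (i.factorial : ℝ) * M i) := hC i hi x
      _ ≤ max C 0 * (ρ ^ i * (i.factorial : ℝ) * M i) := by gcongr; exact le_max_left _ _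
      _ = i.factorial * (M i * (max C 0 * ρ ^ i * 1)) := by ring
      _ ≤ _ := by gcongr
  · have hcat : (catalan k : ℝ) ≤ 4 ^ k := by exact_mod_cast catalan_le_four_pow k
    have p := hM0 k
    have hs : 0 ≤ ∑ j ∈ range (k + 1), (4 * max C 0 * M 1) ^ j *
        (‖iteratedFDeriv ℝ j f (g x)‖ / (j.factorial * M j)) :=
      sum_nonneg fun j _ => by
        have := hM0 j
        positivity
    simp only [add_zero]
    refine mul_le_mul_of_nonneg_right ?_ hs
    calc _ ≤ k.factorial * (M k * (ρ ^ k * 4 ^ k)) := by gcongr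
      _ = _ := by rw [mul_pow]; ring

theorem iteratedFDeriv_comp_sum_le {M : ℕ → ℝ} (hM : IsLogConvexWeight M) {f : E → F} {y : E}
    {B W σ : ℝ} (hB : 0 ≤ B) (hσ : 0 ≤ σ) (hW : 0 ≤ W) (k : ℕ)
    (h : ∀ j, ‖iteratedFDeriv ℝ j f y‖ ≤ W * (σ ^ j * (j.factorial : ℝ) * M j)) :
    ∑ j ∈ range (k + 1), B ^ j * (‖iteratedFDeriv ℝ j f y‖ / (j.factorial * M j)) ≤
      W * (1 + B * σ) ^ k := by
  refine le_trans ?_ (mul_le_mul_of_nonneg_left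
    (sum_range_pow_le_one_add_pow (mul_nonneg hB hσ) k) hW)
  rw [mul_sum]
  refine sum_le_sum fun j _ => ?_
  have p := hM.pos j
  calc _ ≤ B ^ j * (W * σ ^ j) := by
        gcongr
        rw [div_le_iff₀ (by positivity)]
        exact (h j).trans (le_of_eq (by ring))
    _ = _ := by rw [mul_pow]; ring

theorem MemB.comp {t : ClassType} {M : ℕ → ℝ} (hM : IsLogConvexWeight M) {f : E → F} {g : E → E}
    (hf : MemB t M f) (hg : ContDiff ℝ ∞ g) (hgM : HasBoundedDerivs t M g) :
    MemB t M (f ∘ g) := by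
  refine ⟨hf.1.comp hg, Box.comp (fun ρ hρ hP => ?_) hgM hf.2⟩
  obtain ⟨B, hB, h⟩ := exists_norm_iteratedFDeriv_comp_le (F := F) hM hg hρ hP
  refine ⟨B, hB, fun σ hσ ⟨C, hC⟩ r hr h1 h2 => ⟨max C 0, fun k x => (h f hf.1 k x).trans ?_⟩⟩
  have hM0 := fun k => (hM.pos k).le
  have p := hM0 k
  have hC' : ∀ j, ‖iteratedFDeriv ℝ j f (g x)‖ ≤ max C 0 * (σ ^ j * (j.factorial : ℝ) * M j) :=
    fun j => (hC j _).trans (by have := hM0 j; gcongr; exact le_max_left _ _)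
  calc _ ≤ k.factorial * M k * (4 * ρ) ^ k * (max C 0 * (1 + B * σ) ^ k) := by
        gcongr
        exact iteratedFDeriv_comp_sum_le hM hB hσ.le (le_max_right _ _) k hC'
    _ = max C 0 * ((4 * ρ * (1 + B * σ)) ^ k * k.factorial * M k) := by
        rw [mul_pow (4 * ρ)]; ring
    _ ≤ _ := by gcongr

theorem MemS.comp {t : ClassType} {M L : ℕ → ℝ} (hM : IsLogConvexWeight M) (hL : ∀ k, 1 ≤ L k)
    {f : E → F} {g : E → E} (hf : MemS t L M f) (hg : ContDiff ℝ ∞ g)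
    (hgM : HasBoundedDerivs t M g) {c : ℝ} (hc : 0 ≤ c) (hgc : ∀ x, ‖g x - x‖ ≤ c) :
    MemS t L M (f ∘ g) := by
  refine ⟨hf.1.comp hg, Box.comp (fun ρ hρ hP => ?_) hgM hf.2⟩
  obtain ⟨B, hB, h⟩ := exists_norm_iteratedFDeriv_comp_le (F := F) hM hg hρ hP
  -- Since 1 + ‖x‖ ≤ (1 + c)(1 + ‖g x‖), replacing the weight at g x by the one at x costs (1 +
  -- c)^p, so (1 + c)σ ≤ r is needed as well.
  refine ⟨max B (1 + c), le_max_of_le_left hB, fun σ hσ ⟨C, hC⟩ r hr h1 h2 =>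
    ⟨max C 0, fun p q x => ?_⟩⟩
  have hM0 := fun k => (hM.pos k).le
  have p1 := hM0 q
  have p2 : 0 ≤ L p := zero_le_one.trans (hL p)
  have hx : 1 + ‖x‖ ≤ (1 + c) * (1 + ‖g x‖) := by
    have h3 : ‖x‖ ≤ ‖g x‖ + ‖g x - x‖ := by
      have := norm_sub_le (g x) (g x - x)
      rwa [sub_sub_cancel] at this
    nlinarith [hgc x, norm_nonneg (g x)]
  have hy : 0 < 1 + ‖g x‖ := by positivity
  set W := max C 0 * (σ ^ p * p.factorial * L p) / (1 + ‖g x‖) ^ p with hW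
  have hC' : ∀ j, ‖iteratedFDeriv ℝ j f (g x)‖ ≤ W * (σ ^ j * (j.factorial : ℝ) * M j) := by
    intro j
    have p3 := hM0 j
    rw [hW, div_mul_eq_mul_div, le_div_iff₀ (by positivity), mul_comm]
    calc _ ≤ C * (σ ^ (p + j) * p.factorial * j.factorial * L p * M j) := hC p j (g x)
      _ ≤ max C 0 * (σ ^ (p + j) * p.factorial * j.factorial * L p * M j) := by
        gcongr; exact le_max_left _ _
      _ = _ := by rw [pow_add]; ring
  have h3 : B * σ ≤ max B (1 + c) * σ := by gcongr; exact le_max_left _ _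
  have h4 : (1 + c) * σ ≤ max B (1 + c) * σ := by gcongr; exact le_max_right _ _
  calc (1 + ‖x‖) ^ p * ‖iteratedFDeriv ℝ q (f ∘ g) x‖
      ≤ ((1 + c) * (1 + ‖g x‖)) ^ p *
        (q.factorial * M q * (4 * ρ) ^ q * (W * (1 + B * σ) ^ q)) := by
        gcongr
        refine (h f hf.1 q x).trans ?_
        gcongr
        exact iteratedFDeriv_comp_sum_le hM hB hσ.le (by positivity) q hC'
    _ = max C 0 * (((1 + c) * σ) ^ p * (4 * ρ * (1 + B * σ)) ^ q * p.factorial *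
          q.factorial * L p * M q) := by
        rw [hW, mul_pow (1 + c) (1 + ‖g x‖), mul_pow (1 + c) σ, mul_pow (4 * ρ) (1 + B * σ)]
        field_simp
    _ ≤ max C 0 * (r ^ p * r ^ q * p.factorial * q.factorial * L p * M q) := by
        gcongr
        · exact h4.trans h1
        · refine le_trans ?_ h2
          gcongr
    _ = _ := by rw [pow_add]

theorem norm_iteratedFDeriv_id_le (k : ℕ) (hk : 1 ≤ k) (x : E) :
    ‖iteratedFDeriv ℝ k (fun y : E => y) x‖ ≤ if k = 1 then 1 else 0 := by
  obtain ⟨k, rfl⟩ : ∃ l, k = l + 1 := ⟨k - 1, by omega⟩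
  rw [← norm_iteratedFDeriv_fderiv,
    show fderiv ℝ (fun y : E => y) = fun _ => ContinuousLinearMap.id ℝ E from
      funext fun y => fderiv_fun_id]
  rcases k with _ | k
  · simpa using ContinuousLinearMap.norm_id_le
  · rw [iteratedFDeriv_const_of_ne (by omega)]
    simp

theorem hasBoundedDerivs_id {t : ClassType} {M : ℕ → ℝ} (hM : IsWeightSequence t M) :
    HasBoundedDerivs t M fun y : E => y := by
  refine Box.of_forall fun ρ hρ => ⟨1 / ρ, fun k hk x => ?_⟩
  have p := hM.one_le k
  refine (norm_iteratedFDeriv_id_le k hk x).trans ?_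
  split_ifs with h
  · subst h
    rw [pow_one, Nat.factorial_one]
    field_simp
    simpa using p
  · positivity

theorem bound_mono {M : ℕ → ℝ} (hM : IsLogConvexWeight M) {ρ σ C D : ℝ} (hρ : 0 < ρ) (h : ρ ≤ σ)
    (hCD : C ≤ D) (hD : 0 ≤ D) (k : ℕ) :
    C * (ρ ^ k * (k.factorial : ℝ) * M k) ≤ D * (σ ^ k * (k.factorial : ℝ) * M k) := by
  have := (hM.pos k).le
  gcongr

theorem HasBoundedDerivs.add {t : ClassType} {M : ℕ → ℝ} (hM : IsLogConvexWeight M) {f g : E → F}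
    (hfs : ContDiff ℝ ∞ f) (hgs : ContDiff ℝ ∞ g) (hf : HasBoundedDerivs t M f)
    (hg : HasBoundedDerivs t M g) : HasBoundedDerivs t M (f + g) := by
  refine Box.and ?_ ?_ (fun ρ hρ ⟨C, hC⟩ ⟨D, hD⟩ => ⟨C + D, fun k hk x => ?_⟩) hf hg
  · exact fun ρ σ hρ h ⟨C, hC⟩ => ⟨max C 0, fun k hk x =>
      (hC k hk x).trans (bound_mono hM hρ h (le_max_left _ _) (le_max_right _ _) k)⟩
  · exact fun ρ σ hρ h ⟨C, hC⟩ => ⟨max C 0, fun k hk x =>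
      (hC k hk x).trans (bound_mono hM hρ h (le_max_left _ _) (le_max_right _ _) k)⟩
  · rw [iteratedFDeriv_add_apply (hfs.contDiffAt.of_le (by exact_mod_cast le_top))
      (hgs.contDiffAt.of_le (by exact_mod_cast le_top)), add_mul]
    exact (norm_add_le _ _).trans (add_le_add (hC k hk x) (hD k hk x))

theorem HasBoundedDerivs.neg {t : ClassType} {M : ℕ → ℝ} {f : E → F}
    (hf : HasBoundedDerivs t M f) : HasBoundedDerivs t M (-f) :=
  hf.imp fun ρ _ ⟨C, hC⟩ => ⟨C, fun k hk x => by
    rw [iteratedFDeriv_neg_apply, norm_neg]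
    exact hC k hk x⟩

theorem MemB.hasBoundedDerivs {t : ClassType} {M : ℕ → ℝ} {f : E → F} (hf : MemB t M f) :
    HasBoundedDerivs t M f :=
  hf.2.imp fun _ _ ⟨C, hC⟩ => ⟨C, fun k _ x => hC k x⟩

theorem MemB.of_hasBoundedDerivs {t : ClassType} {M : ℕ → ℝ} (hM : IsWeightSequence t M)
    {f : E → F} (hf : ContDiff ℝ ∞ f) (h : HasBoundedDerivs t M f) {c : ℝ} (hc : ∀ x, ‖f x‖ ≤ c) :
    MemB t M f := by
  refine ⟨hf, h.imp fun ρ hρ ⟨C, hC⟩ => ⟨max (max C c) 0, fun k x => ?_⟩⟩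
  rcases k with _ | k
  · rw [norm_iteratedFDeriv_zero]
    simp only [pow_zero, Nat.factorial_zero, Nat.cast_one, hM.zero, mul_one]
    exact (hc x).trans ((le_max_right C c).trans (le_max_left _ _))
  · exact (hC _ (by omega) x).trans (bound_mono hM.isLogConvexWeight hρ le_rfl
      ((le_max_left C c).trans (le_max_left _ _)) (le_max_right _ _) _)

theorem MemB.exists_norm_iteratedFDeriv_le {t : ClassType} {M : ℕ → ℝ} {f : E → F}
    (hf : MemB t M f) (k : ℕ) : ∃ C : ℝ, ∀ x, ‖iteratedFDeriv ℝ k f x‖ ≤ C := by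
  obtain ⟨ρ, -, C, hC⟩ := hf.2.exists
  exact ⟨_, hC k⟩

theorem MemB.exists_norm_le {t : ClassType} {M : ℕ → ℝ} {f : E → F} (hf : MemB t M f) :
    ∃ C : ℝ, ∀ x, ‖f x‖ ≤ C := by
  simpa using hf.exists_norm_iteratedFDeriv_le 0

theorem MemB.exists_norm_fderiv_le {t : ClassType} {M : ℕ → ℝ} {f : E → F} (hf : MemB t M f) :
    ∃ C : ℝ, ∀ x, ‖fderiv ℝ f x‖ ≤ C := by
  simpa [norm_iteratedFDeriv_one] using hf.exists_norm_iteratedFDeriv_le 1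

end Classes

/-! ### Additive structure of the classes and decay of differentials -/

section ClassAlgebra

open Finset Filter Topology

universe u

variable {E F : Type u} [NormedAddCommGroup E] [NormedSpace ℝ E]
  [NormedAddCommGroup F] [NormedSpace ℝ F]

theorem norm_iteratedFDeriv_add_le {f g : E → F} (hf : ContDiff ℝ ∞ f) (hg : ContDiff ℝ ∞ g)
    (k : ℕ) (x : E) : ‖iteratedFDeriv ℝ k (f + g) x‖ ≤
      ‖iteratedFDeriv ℝ k f x‖ + ‖iteratedFDeriv ℝ k g x‖ := by
  rw [iteratedFDeriv_add_apply (hf.contDiffAt.of_le (by exact_mod_cast le_top))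
      (hg.contDiffAt.of_le (by exact_mod_cast le_top))]
  exact norm_add_le _ _

theorem MemB.zero (t : ClassType) (M : ℕ → ℝ) : MemB t M (0 : E → F) :=
  ⟨contDiff_const, Box.of_forall fun ρ _ => ⟨0, fun k x => by
    rw [iteratedFDeriv_zero]; simp⟩⟩

theorem MemB.add {t : ClassType} {M : ℕ → ℝ} (hM : IsWeightSequence t M) {f g : E → F}
    (hf : MemB t M f) (hg : MemB t M g) : MemB t M (f + g) := by
  obtain ⟨C, hC⟩ := hf.exists_norm_le
  obtain ⟨D, hD⟩ := hg.exists_norm_le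
  exact MemB.of_hasBoundedDerivs hM (hf.1.add hg.1)
    (hf.hasBoundedDerivs.add hM.isLogConvexWeight hf.1 hg.1 hg.hasBoundedDerivs)
    fun x => (norm_add_le _ _).trans (add_le_add (hC x) (hD x))

theorem MemB.neg {t : ClassType} {M : ℕ → ℝ} {f : E → F} (hf : MemB t M f) : MemB t M (-f) :=
  ⟨hf.1.neg, hf.2.imp fun ρ _ ⟨C, hC⟩ => ⟨C, fun k x => by
    rw [iteratedFDeriv_neg_apply, norm_neg]; exact hC k x⟩⟩

theorem MemS.zero (t : ClassType) (L M : ℕ → ℝ) : MemS t L M (0 : E → F) :=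
  ⟨contDiff_const, Box.of_forall fun ρ _ => ⟨0, fun p q x => by
    rw [iteratedFDeriv_zero]; simp⟩⟩

theorem MemS.neg {t : ClassType} {L M : ℕ → ℝ} {f : E → F} (hf : MemS t L M f) :
    MemS t L M (-f) :=
  ⟨hf.1.neg, hf.2.imp fun ρ _ ⟨C, hC⟩ => ⟨C, fun p q x => by
    rw [iteratedFDeriv_neg_apply, norm_neg]; exact hC p q x⟩⟩

theorem MemS.add {t : ClassType} {L M : ℕ → ℝ} (hM : IsLogConvexWeight M) (hL : ∀ k, 1 ≤ L k)
    {f g : E → F} (hf : MemS t L M f) (hg : MemS t L M g) : MemS t L M (f + g) := by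
  have hmono : ∀ {h : E → F}, ∀ ρ σ : ℝ, 0 < ρ → ρ ≤ σ →
      (∃ C : ℝ, ∀ (p q : ℕ) (x : E), (1 + ‖x‖) ^ p * ‖iteratedFDeriv ℝ q h x‖ ≤
        C * (ρ ^ (p + q) * (p.factorial : ℝ) * (q.factorial : ℝ) * L p * M q)) →
      (∃ C : ℝ, ∀ (p q : ℕ) (x : E), (1 + ‖x‖) ^ p * ‖iteratedFDeriv ℝ q h x‖ ≤
        C * (σ ^ (p + q) * (p.factorial : ℝ) * (q.factorial : ℝ) * L p * M q)) := by
    rintro h ρ σ hρ hρσ ⟨C, hC⟩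
    refine ⟨max C 0, fun p q x => (hC p q x).trans ?_⟩
    have p1 := (hM.pos q).le
    have p2 : 0 ≤ L p := zero_le_one.trans (hL p)
    gcongr
    exact le_max_left _ _
  refine ⟨hf.1.add hg.1, Box.and hmono hmono (fun ρ hρ ⟨C, hC⟩ ⟨D, hD⟩ => ⟨C + D, fun p q x => ?_⟩)
    hf.2 hg.2⟩
  rw [add_mul]
  refine le_trans ?_ (add_le_add (hC p q x) (hD p q x))
  rw [← mul_add]
  gcongr
  exact norm_iteratedFDeriv_add_le hf.1 hg.1 q x

theorem MemS.memB {t : ClassType} {L M : ℕ → ℝ} {f : E → F} (hf : MemS t L M f) : MemB t M f :=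
  ⟨hf.1, hf.2.imp fun ρ _ ⟨C, hC⟩ => ⟨C * L 0, fun k x => by
    have := hC 0 k x
    simp only [pow_zero, one_mul, zero_add, Nat.factorial_zero, Nat.cast_one, mul_one] at this
    exact this.trans (le_of_eq (by ring))⟩⟩

theorem MemS.tendsto_fderiv [ProperSpace E] {t : ClassType} {L M : ℕ → ℝ} {f : E → F}
    (hf : MemS t L M f) :
    Tendsto (fderiv ℝ f) (cocompact E) (𝓝 0) := by
  obtain ⟨ρ, -, C, hC⟩ := hf.2.exists
  set D := C * (ρ ^ (1 + 1) * (Nat.factorial 1 : ℝ) * (Nat.factorial 1 : ℝ) * L 1 * M 1)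
  rw [tendsto_zero_iff_norm_tendsto_zero]
  refine squeeze_zero (g := fun x => D / (1 + ‖x‖)) (fun x => norm_nonneg _) (fun x => ?_) ?_
  · rw [le_div_iff₀ (by positivity), mul_comm]
    simpa only [pow_one, norm_iteratedFDeriv_one] using hC 1 1 x
  · exact tendsto_const_nhds.div_atTop
      (tendsto_atTop_add_const_left _ _ (tendsto_norm_cocompact_atTop (E := E)))

/-- Derivatives vanish off the support, so the local estimate on the support is global. -/
theorem memD_iff {t : ClassType} {M : ℕ → ℝ} (hM : IsLogConvexWeight M) {f : E → F} :
    MemD t M f ↔ MemB t M f ∧ HasCompactSupport f := by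
  constructor
  · rintro ⟨⟨hs, h⟩, hc⟩
    refine ⟨⟨hs, (h _ hc).imp fun ρ hρ ⟨C, hC⟩ => ⟨max C 0, fun k x => ?_⟩⟩, hc⟩
    by_cases hx : x ∈ tsupport f
    · exact (hC k x hx).trans (bound_mono hM hρ le_rfl (le_max_left _ _) (le_max_right _ _) k)
    · rw [Function.notMem_support.1 fun h => hx (support_iteratedFDeriv_subset k h), norm_zero]
      have := (hM.pos k).le
      positivity
  · rintro ⟨⟨hs, h⟩, hc⟩
    exact ⟨⟨hs, fun K _ => h.imp fun ρ _ ⟨C, hC⟩ => ⟨C, fun k x _ => hC k x⟩⟩, hc⟩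

theorem tendsto_fderiv_of_hasCompactSupport {f : E → F} (hf : HasCompactSupport f) :
    Tendsto (fderiv ℝ f) (cocompact E) (𝓝 0) := by
  refine tendsto_const_nhds.congr' ?_
  filter_upwards [(hf.fderiv ℝ).isCompact.compl_mem_cocompact] with x hx
  exact (image_eq_zero_of_notMem_tsupport hx).symm

end ClassAlgebra

/-! ### Jacobian determinants and the group property -/

section Group

open Filter Topology

/-- The Euclidean space of dimension `n`. -/
abbrev Eucl (n : ℕ) : Type := EuclideanSpace ℝ (Fin n)

variable {n : ℕ}

theorem fderiv_id_add {f : Eucl n → Eucl n} (hf : ContDiff ℝ ∞ f) (x : Eucl n) :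
    fderiv ℝ (fun y => y + f y) x = ContinuousLinearMap.id ℝ (Eucl n) + fderiv ℝ f x := by
  rw [fderiv_fun_add differentiableAt_fun_id (hf.differentiable (by simp) x), fderiv_fun_id]

theorem det_fderiv_id_add {f : Eucl n → Eucl n} (hf : ContDiff ℝ ∞ f) (x : Eucl n) :
    (fderiv ℝ (fun y => y + f y) x).det = jacDet f x := by
  rw [fderiv_id_add hf, jacDet]

theorem contDiff_id_add {f : Eucl n → Eucl n} (hf : ContDiff ℝ ∞ f) :
    ContDiff ℝ ∞ fun y => y + f y := contDiff_id.add hf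

theorem jacDet_zero (x : Eucl n) : jacDet (0 : Eucl n → Eucl n) x = 1 := by
  rw [jacDet, fderiv_zero]
  simp [ContinuousLinearMap.det]

theorem det_mul (S T : Eucl n →L[ℝ] Eucl n) : (S.comp T).det = S.det * T.det := by
  simp [ContinuousLinearMap.det, LinearMap.det_comp]

theorem jacDet_comp {f g : Eucl n → Eucl n} (hf : ContDiff ℝ ∞ f) (hg : ContDiff ℝ ∞ g)
    (x : Eucl n) :
    jacDet (g + f ∘ fun y => y + g y) x = jacDet f (x + g x) * jacDet g x := by
  have hG := contDiff_id_add hg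
  have hs : ContDiff ℝ ∞ (g + f ∘ fun y => y + g y) := hg.add (hf.comp hG)
  rw [← det_fderiv_id_add hs, ← det_fderiv_id_add hf, ← det_fderiv_id_add hg,
    ← det_mul, ← fderiv_comp x ((contDiff_id_add hf).differentiable (by simp) _)
      (hG.differentiable (by simp) _)]
  congr 2
  ext1 y
  simp [add_assoc]

/-- The determinant tends to 1, so it is at least 1/2 off a compact set, and on that set it attains
a positive minimum. -/
theorem exists_pos_le_jacDet {f : Eucl n → Eucl n} (hf : ContDiff ℝ ∞ f)
    (h : Tendsto (fderiv ℝ f) (cocompact (Eucl n)) (𝓝 0)) (hpos : ∀ x, 0 < jacDet f x) :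
    ∃ c : ℝ, 0 < c ∧ ∀ x, c ≤ jacDet f x := by
  have hcont : Continuous (jacDet f) :=
    ContinuousLinearMap.continuous_det.comp
      (continuous_const.add (hf.continuous_fderiv (by simp)))
  have hlim : Tendsto (jacDet f) (cocompact (Eucl n)) (𝓝 1) := by
    have h1 : Tendsto (fun x => ContinuousLinearMap.id ℝ (Eucl n) + fderiv ℝ f x)
        (cocompact (Eucl n)) (𝓝 (ContinuousLinearMap.id ℝ (Eucl n) + 0)) :=
      tendsto_const_nhds.add h
    have h2 := (ContinuousLinearMap.continuous_det.tendsto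
      (ContinuousLinearMap.id ℝ (Eucl n) + 0)).comp h1
    have h3 : (ContinuousLinearMap.id ℝ (Eucl n) + 0).det = 1 := by
      simp [ContinuousLinearMap.det]
    rwa [h3] at h2
  obtain ⟨K, hK, hKc⟩ := mem_cocompact.1 (hlim.eventually_const_le (by norm_num : (1 / 2 : ℝ) < 1))
  rcases K.eq_empty_or_nonempty with rfl | hne
  · exact ⟨1 / 2, by norm_num, fun x => hKc (Set.mem_compl (Set.notMem_empty x))⟩
  · obtain ⟨x₀, -, hx₀⟩ := hK.exists_isMinOn hne hcont.continuousOn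
    refine ⟨min (1 / 2) (jacDet f x₀), lt_min (by norm_num) (hpos x₀), fun x => ?_⟩
    by_cases hx : x ∈ K
    · exact (min_le_right _ _).trans (hx₀ hx)
    · exact (min_le_left _ _).trans (hKc hx)

theorem exists_jacDet_le {f : Eucl n → Eucl n} {C : ℝ} (hC : ∀ x, ‖fderiv ℝ f x‖ ≤ C) :
    ∃ D : ℝ, 0 < D ∧ ∀ x, jacDet f x ≤ D := by
  have : ProperSpace (Eucl n →L[ℝ] Eucl n) := FiniteDimensional.proper ℝ _
  obtain ⟨D, hD⟩ := (isCompact_closedBall (0 : Eucl n →L[ℝ] Eucl n) C).exists_bound_of_continuousOn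
    (f := fun T => (ContinuousLinearMap.id ℝ (Eucl n) + T).det)
    (ContinuousLinearMap.continuous_det.comp (continuous_const.add continuous_id)).continuousOn
  refine ⟨max D 1, by positivity, fun x => ?_⟩
  exact (le_abs_self _).trans ((hD _ (by simpa using hC x)).trans (le_max_left _ _))

/-- Mappings `Id + f` with `f` of class `𝓑^[M]` and Jacobian determinant bounded away from zero
are diffeomorphisms, and their inverses are of the same type. -/
theorem MemB.exists_inverse {t : ClassType} {M : ℕ → ℝ} (hM : IsWeightSequence t M)
    {f : Eucl n → Eucl n} (hf : MemB t M f) {c : ℝ} (hc : 0 < c) (hfc : ∀ x, c ≤ jacDet f x) :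
    ∃ g : Eucl n → Eucl n, MemB t M g ∧ (∃ d : ℝ, 0 < d ∧ ∀ x, d ≤ jacDet g x) ∧
      (∀ x, (x + g x) + f (x + g x) = x) ∧ ∀ x, (x + f x) + g (x + f x) = x := by
  obtain ⟨B, hB⟩ := hf.exists_norm_le
  obtain ⟨C, hC⟩ := hf.exists_norm_fderiv_le
  set F : Eucl n → Eucl n := fun x => x + f x with hF
  have hFs : ContDiff ℝ ∞ F := contDiff_id_add hf.1
  have hdet : ∀ x, c ≤ (fderiv ℝ F x).det := fun x => by
    rw [det_fderiv_id_add hf.1]; exact hfc x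
  obtain ⟨G, hGs, hFG, hGF⟩ := exists_smooth_inverse hFs (tendsto_cocompact_id_add hB)
    fun x => (hc.trans_le (hdet x)).ne'
  obtain ⟨K, hK⟩ := exists_norm_inverse_le (E := Eucl n) (1 + C) hc
  have hunit : ∀ x, IsUnit (fderiv ℝ F x) := fun x =>
    isUnit_of_det_ne_zero (hc.trans_le (hdet x)).ne'
  have hF' : ∀ x, ‖fderiv ℝ F x‖ ≤ 1 + C := fun x => by
    rw [fderiv_id_add hf.1]
    exact (norm_add_le _ _).trans (add_le_add ContinuousLinearMap.norm_id_le (hC x))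
  have hFM : HasBoundedDerivs t M F :=
    (hasBoundedDerivs_id hM).add hM.isLogConvexWeight contDiff_id hf.1 hf.hasBoundedDerivs
  have hGM : HasBoundedDerivs t M G := box_bound_of_rightInverse hM hFs hGs hFG
    (H := fun x => Ring.inverse (fderiv ℝ F x))
    (fun x => Ring.mul_inverse_cancel _ (hunit x)) (fun x => Ring.inverse_mul_cancel _ (hunit x))
    (fun x => hK _ (hF' x) (hdet x)) hFM
  set g : Eucl n → Eucl n := G + -(fun x => x) with hg
  have hGg : ∀ x, x + g x = G x := fun x => by simp [hg]
  have hgs : ContDiff ℝ ∞ g := hGs.add contDiff_id.neg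
  -- This bounds g itself; its derivatives of positive order are controlled through those of G.
  have hgf : ∀ x, g x = -f (G x) := fun x => by
    have h1 : G x + f (G x) = x := hFG x
    rw [hg, Pi.add_apply, Pi.neg_apply]
    nth_rewrite 2 [← h1]
    abel
  have hgB : MemB t M g := MemB.of_hasBoundedDerivs hM hgs
    (hGM.add hM.isLogConvexWeight hGs contDiff_id.neg (hasBoundedDerivs_id hM).neg)
    (c := B) fun x => by rw [hgf, norm_neg]; exact hB _
  obtain ⟨D, hD0, hD⟩ := exists_jacDet_le hC
  refine ⟨g, hgB, ⟨D⁻¹, by positivity, fun x => ?_⟩, fun x => ?_, fun x => ?_⟩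
  -- The two determinants multiply to 1, and that of Id + f is at most D.
  · have h1 := jacDet_comp hf.1 hgs x
    have h2 : (g + f ∘ fun y => y + g y) = 0 := by
      ext1 y
      change g y + f (y + g y) = 0
      rw [hGg, hgf, neg_add_cancel]
    rw [h2, jacDet_zero] at h1
    have h3 := hc.trans_le (hfc (x + g x))
    have h4 := hD (x + g x)
    have h5 : 0 < jacDet g x := by
      by_contra! h
      nlinarith
    rw [inv_le_iff_one_le_mul₀ hD0, mul_comm]
    nlinarith
  · rw [hGg]; exact hFG x
  · exact (hGg _).trans (hGF x)

/-- A class of mappings contained in `𝓑^[M]` which is an additive group and stable under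
composition with the elements of `Diff 𝓑^[M]` gives rise to a group of diffeomorphisms. -/
theorem isGroupUnderComposition_of_class {t : ClassType} {M : ℕ → ℝ} (hM : IsWeightSequence t M)
    (P : (Eucl n → Eucl n) → Prop) (hzero : P 0) (hadd : ∀ f g, P f → P g → P (f + g))
    (hneg : ∀ f, P f → P (-f)) (hPB : ∀ f, P f → MemB t M f)
    (hcomp : ∀ f g, P f → MemB t M g → (∃ c : ℝ, 0 < c ∧ ∀ x, c ≤ jacDet g x) →
      (Function.Bijective fun x => x + g x) → P (f ∘ fun x => x + g x)) :
    IsGroupUnderComposition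
      {F : Eucl n → Eucl n | ∃ f, (∀ x, F x = x + f x) ∧ P f ∧
        ∃ c : ℝ, 0 < c ∧ ∀ x, c ≤ jacDet f x} := by
  have hbij : ∀ f : Eucl n → Eucl n, MemB t M f → (∃ c : ℝ, 0 < c ∧ ∀ x, c ≤ jacDet f x) →
      Function.Bijective fun x => x + f x := by
    rintro f hf ⟨c, hc, hfc⟩
    obtain ⟨g, -, -, h1, h2⟩ := hf.exists_inverse hM hc hfc
    exact Function.bijective_iff_has_inverse.2 ⟨fun x => x + g x, h2, h1⟩
  refine ⟨⟨0, by simp, hzero, 1, one_pos, fun x => (jacDet_zero x).ge⟩, ?_, ?_⟩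
  · rintro F ⟨f, hF, hf, c, hc, hfc⟩ G ⟨g, hG, hg, d, hd, hgd⟩
    have hgB := hPB g hg
    refine ⟨g + f ∘ fun x => x + g x, fun x => ?_, hadd _ _ hg
      (hcomp f g hf hgB ⟨d, hd, hgd⟩ (hbij g hgB ⟨d, hd, hgd⟩)), c * d, by positivity, fun x => ?_⟩
    · simp [hF, hG, add_assoc]
    · rw [jacDet_comp (hPB f hf).1 hgB.1]
      exact mul_le_mul (hfc _) (hgd _) hd.le (hc.le.trans (hfc _))
  · rintro F ⟨f, hF, hf, c, hc, hfc⟩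
    obtain ⟨g, hg, hgd, h1, h2⟩ := (hPB f hf).exists_inverse hM hc hfc
    -- It suffices to know g in 𝓑: this identity then puts g into the smaller class.
    have hgf : g = -(f ∘ fun x => x + g x) := by
      ext1 x
      have h3 := h1 x
      rw [add_assoc, add_eq_left] at h3
      exact eq_neg_of_add_eq_zero_left h3
    have hPg : P g := by
      rw [hgf]
      exact hneg _ (hcomp f g hf hg hgd (hbij g hg hgd))
    refine ⟨fun x => x + g x, ⟨g, fun x => rfl, hPg, hgd⟩, ?_, ?_⟩
    · ext1 x
      simpa [hF] using h1 x
    · ext1 x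
      simpa [hF] using h2 x

theorem isGroupUnderComposition_of_class_of_tendsto {t : ClassType} {M : ℕ → ℝ}
    (hM : IsWeightSequence t M)
    (P : (Eucl n → Eucl n) → Prop) (hzero : P 0) (hadd : ∀ f g, P f → P g → P (f + g))
    (hneg : ∀ f, P f → P (-f)) (hPB : ∀ f, P f → MemB t M f)
    (hlim : ∀ f, P f → Tendsto (fderiv ℝ f) (cocompact (Eucl n)) (𝓝 0))
    (hcomp : ∀ f g, P f → MemB t M g → (∃ c : ℝ, 0 < c ∧ ∀ x, c ≤ jacDet g x) →
      (Function.Bijective fun x => x + g x) → P (f ∘ fun x => x + g x)) :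
    IsGroupUnderComposition
      {F : Eucl n → Eucl n | ∃ f, (∀ x, F x = x + f x) ∧ P f ∧ ∀ x, 0 < jacDet f x} := by
  convert isGroupUnderComposition_of_class hM P hzero hadd hneg hPB hcomp using 5 with F f
  refine and_congr_right fun _ => and_congr_right fun hf => ⟨exists_pos_le_jacDet (hPB f hf).1 (hlim f hf), ?_⟩
  rintro ⟨c, hc, h⟩ x
  exact hc.trans_le (h x)

theorem isGroupUnderComposition_diffB {t : ClassType} {M : ℕ → ℝ} (hM : IsWeightSequence t M) :
    IsGroupUnderComposition (DiffB n t M) :=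
  isGroupUnderComposition_of_class hM (MemB t M) (MemB.zero t M) (fun _ _ => MemB.add hM)
    (fun _ => MemB.neg) (fun _ => id) fun _ _ hf hg _ _ =>
    hf.comp hM.isLogConvexWeight (contDiff_id_add hg.1)
      ((hasBoundedDerivs_id hM).add hM.isLogConvexWeight contDiff_id hg.1 hg.hasBoundedDerivs)

theorem isGroupUnderComposition_diffS {t : ClassType} {L M : ℕ → ℝ} (hM : IsWeightSequence t M)
    (hL : ∀ k, 1 ≤ L k) : IsGroupUnderComposition (DiffS n t L M) := by
  refine isGroupUnderComposition_of_class_of_tendsto hM (MemS t L M) (MemS.zero t L M)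
    (fun _ _ => MemS.add hM.isLogConvexWeight hL)
    (fun _ => MemS.neg) (fun _ => MemS.memB) (fun _ => MemS.tendsto_fderiv)
    fun f g hf hg _ _ => ?_
  obtain ⟨B, hB⟩ := hg.exists_norm_le
  exact hf.comp hM.isLogConvexWeight hL (contDiff_id_add hg.1)
      ((hasBoundedDerivs_id hM).add hM.isLogConvexWeight contDiff_id hg.1 hg.hasBoundedDerivs)
      ((norm_nonneg _).trans (hB 0)) fun x => by simpa using hB x

theorem isGroupUnderComposition_diffD {t : ClassType} {M : ℕ → ℝ} (hM : IsWeightSequence t M) :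
    IsGroupUnderComposition (DiffD n t M) := by
  have hMw := hM.isLogConvexWeight
  refine isGroupUnderComposition_of_class_of_tendsto hM (MemD t M)
    ((memD_iff hMw).2 ⟨MemB.zero t M, HasCompactSupport.zero⟩) (fun f g hf hg => ?_)
    (fun f hf => ?_) (fun f hf => ((memD_iff hMw).1 hf).1)
    (fun f hf => tendsto_fderiv_of_hasCompactSupport hf.2) fun f g hf hg _ _ => ?_
  · rw [memD_iff hMw] at *
    exact ⟨hf.1.add hM hg.1, hf.2.add hg.2⟩
  · rw [memD_iff hMw] at *
    exact ⟨hf.1.neg, hf.2.comp_left (g := fun y => -y) neg_zero⟩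
  · rw [memD_iff hMw] at *
    refine ⟨hf.1.comp hMw (contDiff_id_add hg.1)
      ((hasBoundedDerivs_id hM).add hMw contDiff_id hg.1 hg.hasBoundedDerivs), ?_⟩
    obtain ⟨B, hB⟩ := hg.exists_norm_le
    -- The composite vanishes off the preimage of the support of f, compact by properness.
    have hprop : IsProperMap fun x => x + g x := isProperMap_iff_tendsto_cocompact.2
      ⟨(contDiff_id_add hg.1).continuous, tendsto_cocompact_id_add hB⟩
    refine HasCompactSupport.intro (hprop.isCompact_preimage hf.2.isCompact) fun x hx => ?_
    exact image_eq_zero_of_notMem_tsupport (f := f) hx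

end Group

/-! ### Sobolev inequality on unit cubes and decay at infinity -/

section Sobolev

open Finset Filter Topology MeasureTheory

/-- The fundamental theorem of calculus between s and t, averaged over s in an interval of length 1.
-/
theorem enorm_le_lintegral_Icc {V : Type*} [NormedAddCommGroup V] [NormedSpace ℝ V] {v : ℝ → V}
    (hv : ContDiff ℝ 1 v) {a t : ℝ} (ht : t ∈ Set.Icc a (a + 1)) :
    ‖v t‖ₑ ≤ ∫⁻ s in Set.Icc a (a + 1), (‖v s‖ₑ + ‖deriv v s‖ₑ) := by
  set J := ∫⁻ s in Set.Icc a (a + 1), ‖deriv v s‖ₑ with hJ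
  have hvol : volume (Set.Icc a (a + 1)) = 1 := by simp
  have key : ∀ s ∈ Set.Icc a (a + 1), ‖v t‖ₑ ≤ ‖v s‖ₑ + J := by
    intro s hs
    have h1 : ‖v t - v s‖ₑ ≤ J := by
      rcases le_total s t with h | h
      · exact (enorm_sub_le_lintegral_deriv_of_contDiffOn_Icc hv.contDiffOn h).trans
          (lintegral_mono_set (Set.Icc_subset_Icc hs.1 ht.2))
      · rw [← enorm_neg, neg_sub]
        exact (enorm_sub_le_lintegral_deriv_of_contDiffOn_Icc hv.contDiffOn h).trans
          (lintegral_mono_set (Set.Icc_subset_Icc ht.1 hs.2))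
    calc ‖v t‖ₑ = ‖v s + (v t - v s)‖ₑ := by rw [add_sub_cancel]
      _ ≤ ‖v s‖ₑ + ‖v t - v s‖ₑ := enorm_add_le _ _
      _ ≤ _ := by gcongr
  calc ‖v t‖ₑ = ∫⁻ _ in Set.Icc a (a + 1), ‖v t‖ₑ := by simp [hvol]
    _ ≤ ∫⁻ s in Set.Icc a (a + 1), (‖v s‖ₑ + J) := setLIntegral_mono' measurableSet_Icc key
    _ = _ := by
      rw [lintegral_add_right _ measurable_const, lintegral_add_left
        hv.continuous.enorm.measurable]
      simp [hvol, hJ]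

/-- Iterated sums of a sequence of functions and its shifts. -/
def binomSum {X : Type*} (ψ : ℕ → X → ℝ≥0∞) : ℕ → ℕ → X → ℝ≥0∞
  | 0, j => ψ j
  | m + 1, j => fun x => binomSum ψ m j x + binomSum ψ m (j + 1) x

theorem measurable_binomSum {X : Type*} [MeasurableSpace X] {ψ : ℕ → X → ℝ≥0∞}
    (hψ : ∀ j, Measurable (ψ j)) (m j : ℕ) : Measurable (binomSum ψ m j) := by
  induction m generalizing j with
  | zero => exact hψ j
  | succ m ih => exact (ih j).add (ih (j + 1))

theorem binomSum_le {X : Type*} (ψ : ℕ → X → ℝ≥0∞) (m j : ℕ) (x : X) :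
    binomSum ψ m j x ≤ 2 ^ m * ∑ l ∈ range (m + 1), ψ (j + l) x := by
  induction m generalizing j with
  | zero => simp [binomSum]
  | succ m ih =>
    have h1 : ∑ l ∈ range (m + 1), ψ (j + l) x ≤ ∑ l ∈ range (m + 1 + 1), ψ (j + l) x :=
      sum_le_sum_of_subset (range_mono (by omega))
    have h2 : ∑ l ∈ range (m + 1), ψ (j + 1 + l) x ≤ ∑ l ∈ range (m + 1 + 1), ψ (j + l) x := by
      rw [sum_range_succ' _ (m + 1)]
      refine le_add_right (le_of_eq (sum_congr rfl fun l _ => ?_))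
      rw [show j + 1 + l = j + (l + 1) by ring]
    calc binomSum ψ (m + 1) j x
        ≤ 2 ^ m * ∑ l ∈ range (m + 1 + 1), ψ (j + l) x +
          2 ^ m * ∑ l ∈ range (m + 1 + 1), ψ (j + l) x :=
          add_le_add ((ih j).trans (by gcongr)) ((ih (j + 1)).trans (by gcongr))
      _ = _ := by rw [pow_succ]; ring

variable {n : ℕ}

/-- The one-dimensional inequality is used in one coordinate after another; each use adds the next
ψ, which is the recursion of `binomSum`. -/
theorem le_lmarginal_binomSum {ψ : ℕ → (Fin n → ℝ) → ℝ≥0∞} (hψ : ∀ j, Measurable (ψ j))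
    (a : Fin n → ℝ)
    (h : ∀ j x i, x i ∈ Set.Icc (a i) (a i + 1) →
      ψ j x ≤ ∫⁻ s in Set.Icc (a i) (a i + 1),
        (ψ j (Function.update x i s) + ψ (j + 1) (Function.update x i s)))
    (s : Finset (Fin n)) (j : ℕ) (x : Fin n → ℝ) (hx : ∀ i, x i ∈ Set.Icc (a i) (a i + 1)) :
    ψ j x ≤ lmarginal (fun i => (volume : Measure ℝ).restrict (Set.Icc (a i) (a i + 1))) s
      (binomSum ψ #s j) x := by
  induction s using Finset.induction_on generalizing j x with
  | empty => simp [binomSum]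
  | insert i s hi ih =>
    rw [lmarginal_insert _ (measurable_binomSum hψ _ _) hi, card_insert_of_notMem hi]
    refine (h j x i (hx i)).trans (setLIntegral_mono' measurableSet_Icc fun y hy => ?_)
    have hx' : ∀ k, Function.update x i y k ∈ Set.Icc (a k) (a k + 1) := fun k => by
      rcases eq_or_ne k i with rfl | hk
      · simpa using hy
      · simpa [Function.update_of_ne hk] using hx k
    refine (add_le_add (ih j _ hx') (ih (j + 1) _ hx')).trans (le_of_eq ?_)
    rw [lmarginal, lmarginal, ← lintegral_add_left]
    · rfl
    · exact (measurable_binomSum hψ _ _).comp measurable_updateFinset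

/-- The unit cube with lower corner `x`. -/
def unitCube (x : Eucl n) : Set (Eucl n) := {y | ∀ i, y i ∈ Set.Icc (x i) (x i + 1)}

theorem preimage_unitCube (x : Eucl n) :
    (WithLp.toLp 2) ⁻¹' unitCube x = Set.univ.pi fun i => Set.Icc (x i) (x i + 1) := by
  ext y
  simp only [unitCube, Set.mem_preimage, Set.mem_ofPred_eq, Set.mem_univ_pi]

theorem isClosed_unitCube (x : Eucl n) : IsClosed (unitCube x) := by
  have : unitCube x = ⋂ i, (fun y : Eucl n => y i) ⁻¹' Set.Icc (x i) (x i + 1) := by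
    ext y; simp [unitCube]
  rw [this]
  exact isClosed_iInter fun i => isClosed_Icc.preimage (by fun_prop)

theorem volume_unitCube (x : Eucl n) : volume (unitCube x) = 1 := by
  rw [← (PiLp.volume_preserving_toLp (Fin n)).measure_preimage
    (isClosed_unitCube x).measurableSet.nullMeasurableSet, preimage_unitCube, volume_pi_pi]
  simp

theorem norm_sub_le_of_mem_unitCube {x y : Eucl n} (hy : y ∈ unitCube x) : ‖y - x‖ ≤ n := by
  have h1 : ‖y - x‖ ^ 2 ≤ n := by
    rw [EuclideanSpace.real_norm_sq_eq]
    calc ∑ i, ((y - x) i) ^ 2 ≤ ∑ _i : Fin n, (1 : ℝ) := by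
          refine sum_le_sum fun i _ => ?_
          have := hy i
          rw [PiLp.sub_apply]
          nlinarith [this.1, this.2]
      _ = n := by simp
  have h2 : (n : ℝ) ≤ (n : ℝ) ^ 2 := by
    exact_mod_cast Nat.le_self_pow two_ne_zero n
  exact (sq_le_sq₀ (norm_nonneg _) (Nat.cast_nonneg n)).1 (h1.trans h2)

/-- Local Sobolev inequality on unit cubes. -/
theorem enorm_iteratedFDeriv_le_lintegral {V : Type*} [NormedAddCommGroup V] [NormedSpace ℝ V]
    {f : Eucl n → V} (hf : ContDiff ℝ ∞ f) (j : ℕ) (x : Eucl n) :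
    ‖iteratedFDeriv ℝ j f x‖ₑ ≤ 2 ^ n * ∑ l ∈ range (n + 1),
      ∫⁻ y in unitCube x, ‖iteratedFDeriv ℝ (j + l) f y‖ₑ := by
  have hcont : ∀ j, Continuous (iteratedFDeriv ℝ j f) := fun j =>
    hf.continuous_iteratedFDeriv (by exact_mod_cast le_top)
  set φ : ℕ → Eucl n → ℝ≥0∞ := fun j y => ‖iteratedFDeriv ℝ j f y‖ₑ with hφ
  have hφm : ∀ j, Measurable (φ j) := fun j => (hcont j).enorm.measurable
  have hto : Measurable (WithLp.toLp 2 : (Fin n → ℝ) → Eucl n) :=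
    (PiLp.volume_preserving_toLp (Fin n)).measurable
  set ψ : ℕ → (Fin n → ℝ) → ℝ≥0∞ := fun j y => φ j (WithLp.toLp 2 y) with hψ
  have hψm : ∀ j, Measurable (ψ j) := fun j => (hφm j).comp hto
  have hline : ∀ j (z : Fin n → ℝ) i, z i ∈ Set.Icc (x i) (x i + 1) →
      ψ j z ≤ ∫⁻ s in Set.Icc (x i) (x i + 1),
        (ψ j (Function.update z i s) + ψ (j + 1) (Function.update z i s)) := by
    intro j z i hz
    set v : ℝ → (Eucl n) [×j]→L[ℝ] V :=
      fun s => iteratedFDeriv ℝ j f (WithLp.toLp 2 (Function.update z i s)) with hv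
    have hjs : ContDiff ℝ 1 (iteratedFDeriv ℝ j f) :=
      hf.iteratedFDeriv_right (m := 1) (by exact_mod_cast le_top)
    have hγ : ∀ s, HasDerivAt (fun s => (WithLp.toLp 2 (Function.update z i s) : Eucl n))
        (EuclideanSpace.single i 1) s := fun s => by
      have h1 := hasDerivAt_update z i s
      have h2 := ((PiLp.continuousLinearEquiv 2 ℝ fun _ : Fin n => ℝ).symm
        |>.toContinuousLinearMap.hasFDerivAt).comp_hasDerivAt s h1
      exact h2
    have hγs : ContDiff ℝ 1 fun s => (WithLp.toLp 2 (Function.update z i s) : Eucl n) := by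
      refine contDiff_one_iff_deriv.2 ⟨fun s => (hγ s).differentiableAt, ?_⟩
      rw [show deriv (fun s => (WithLp.toLp 2 (Function.update z i s) : Eucl n)) =
        fun _ => EuclideanSpace.single i 1 from funext fun s => (hγ s).deriv]
      exact continuous_const
    have hvs : ContDiff ℝ 1 v := hjs.comp hγs
    -- The derivative along a coordinate line is the derivative of order j + 1 with one slot filled
    -- by a unit vector.
    have hvd : ∀ s, ‖deriv v s‖ₑ ≤ ψ (j + 1) (Function.update z i s) := by
      intro s
      have h1 := ((hjs.differentiable (by simp)
        (WithLp.toLp 2 (Function.update z i s))).hasFDerivAt).comp_hasDerivAt s (hγ s)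
      rw [show deriv v s = _ from h1.deriv]
      rw [enorm_le_iff_norm_le, ← norm_fderiv_iteratedFDeriv]
      refine (ContinuousLinearMap.le_opNorm _ _).trans (le_of_eq ?_)
      simp
    have h1 := enorm_le_lintegral_Icc hvs hz
    have h2 : v (z i) = iteratedFDeriv ℝ j f (WithLp.toLp 2 z) := by
      simp [hv, Function.update_eq_self]
    rw [h2] at h1
    exact h1.trans (lintegral_mono fun s => add_le_add le_rfl (hvd s))
  have hx0 : ∀ i, (WithLp.ofLp x) i ∈ Set.Icc (x i) (x i + 1) := fun i =>
    ⟨le_rfl, by linarith⟩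
  have main := le_lmarginal_binomSum hψm (fun i => x i) hline univ j (WithLp.ofLp x) hx0
  rw [lmarginal_univ] at main
  simp only [card_univ, Fintype.card_fin] at main
  rw [← Measure.restrict_pi_pi, ← volume_pi, ← preimage_unitCube] at main
  calc φ j x ≤ ∫⁻ y in WithLp.toLp 2 ⁻¹' unitCube x, binomSum ψ n j y := main
    _ ≤ ∫⁻ y in WithLp.toLp 2 ⁻¹' unitCube x, 2 ^ n * ∑ l ∈ range (n + 1), ψ (j + l) y :=
        lintegral_mono fun y => binomSum_le ψ n j y
    _ = 2 ^ n * ∑ l ∈ range (n + 1), ∫⁻ y in WithLp.toLp 2 ⁻¹' unitCube x, ψ (j + l) y := by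
        rw [lintegral_const_mul _ (Finset.measurable_sum _ fun l _ => hψm _),
          lintegral_finsetSum _ fun l _ => hψm _]
    _ = _ := by
        congr 1
        refine sum_congr rfl fun l _ => ?_
        exact (PiLp.volume_preserving_toLp (Fin n)).setLIntegral_comp_preimage
          (isClosed_unitCube x).measurableSet (hφm (j + l))

/-- The cube has measure 1, so the L^1 norm over it is at most the L^p norm. -/
theorem enorm_iteratedFDeriv_le_eLpNorm_restrict {V : Type*} [NormedAddCommGroup V]
    [NormedSpace ℝ V] {f : Eucl n → V} (hf : ContDiff ℝ ∞ f) {p : ℝ≥0∞} (hp : 1 ≤ p) (j : ℕ)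
    (x : Eucl n) :
    ‖iteratedFDeriv ℝ j f x‖ₑ ≤ 2 ^ n * ∑ l ∈ range (n + 1),
      eLpNorm (fun y => ‖iteratedFDeriv ℝ (j + l) f y‖) p (volume.restrict (unitCube x)) := by
  have : IsProbabilityMeasure ((volume : Measure (Eucl n)).restrict (unitCube x)) :=
    ⟨by rw [Measure.restrict_apply_univ, volume_unitCube]⟩
  refine (enorm_iteratedFDeriv_le_lintegral hf j x).trans ?_
  gcongr with l _
  have hcont : Continuous (iteratedFDeriv ℝ (j + l) f) :=
    hf.continuous_iteratedFDeriv (by exact_mod_cast le_top)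
  refine le_trans (le_of_eq ?_) (eLpNorm_le_eLpNorm_of_exponent_le hp
    hcont.norm.aestronglyMeasurable)
  rw [eLpNorm_one_eq_lintegral_enorm]
  simp

/-- For finite p, h is L^p-close to a compactly supported function, whose support is missed by the
cubes with distant corner. -/
theorem tendsto_eLpNorm_restrict_unitCube {h : Eucl n → ℝ} {p : ℝ≥0∞} (hp_top : p ≠ ⊤)
    (hh : MemLp h p volume) :
    Tendsto (fun x => eLpNorm h p (volume.restrict (unitCube x))) (cocompact (Eucl n)) (𝓝 0) := by
  rw [ENNReal.tendsto_nhds_zero]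
  intro ε hε
  obtain ⟨g, hg, hgε, -, -⟩ := hh.exists_hasCompactSupport_eLpNorm_sub_le hp_top hε.ne'
  obtain ⟨R, hR⟩ := hg.isCompact.isBounded.subset_closedBall (0 : Eucl n)
  have hev : ∀ᶠ x : Eucl n in cocompact (Eucl n), R + n < ‖x‖ :=
    tendsto_norm_cocompact_atTop.eventually_gt_atTop _
  filter_upwards [hev] with x hx
  refine le_trans (le_of_eq ?_) ((eLpNorm_mono_measure (h - g)
    (Measure.restrict_le_self (s := unitCube x))).trans hgε)
  refine eLpNorm_congr_ae ?_
  filter_upwards [ae_restrict_mem (isClosed_unitCube x).measurableSet] with y hy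
  have : y ∉ tsupport g := fun hy' => by
    have h1 := hR hy'
    rw [mem_closedBall_zero_iff] at h1
    have h2 := norm_sub_le_of_mem_unitCube hy
    have h3 := norm_sub_le y (y - x)
    rw [sub_sub_cancel] at h3
    linarith
  simp [image_eq_zero_of_notMem_tsupport this]

theorem tendsto_fderiv_of_memLp {V : Type*} [NormedAddCommGroup V]
    [NormedSpace ℝ V] {f : Eucl n → V} (hf : ContDiff ℝ ∞ f) {p : ℝ≥0∞} (hp : 1 ≤ p)
    (hp_top : p ≠ ⊤) (hfp : ∀ k, MemLp (fun y => ‖iteratedFDeriv ℝ k f y‖) p volume) :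
    Tendsto (fderiv ℝ f) (cocompact (Eucl n)) (𝓝 0) := by
  rw [tendsto_zero_iff_enorm_tendsto_zero]
  have h1 : Tendsto (fun x => (2 : ℝ≥0∞) ^ n * ∑ l ∈ range (n + 1),
      eLpNorm (fun y => ‖iteratedFDeriv ℝ (1 + l) f y‖) p (volume.restrict (unitCube x)))
      (cocompact (Eucl n)) (𝓝 0) := by
    have h2 : Tendsto (fun x => ∑ l ∈ range (n + 1),
      eLpNorm (fun y => ‖iteratedFDeriv ℝ (1 + l) f y‖) p (volume.restrict (unitCube x)))
      (cocompact (Eucl n)) (𝓝 (∑ l ∈ range (n + 1), 0)) :=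
      tendsto_finsetSum _ fun l _ => tendsto_eLpNorm_restrict_unitCube hp_top (hfp _)
    have h3 := ENNReal.Tendsto.const_mul (a := (2 : ℝ≥0∞) ^ n) h2
      (Or.inr (ENNReal.pow_ne_top (by simp)))
    simpa using h3
  refine tendsto_of_tendsto_of_tendsto_of_le_of_le tendsto_const_nhds h1 (fun _ => bot_le)
    fun x => ?_
  refine le_trans (le_of_eq ?_) (enorm_iteratedFDeriv_le_eLpNorm_restrict hf hp 1 x)
  rw [← ofReal_norm, ← ofReal_norm, norm_iteratedFDeriv_one]

end Sobolev

/-! ### Partial derivatives versus Fréchet derivatives -/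

section Partial

open Finset

variable {E F : Type*} [NormedAddCommGroup E] [NormedSpace ℝ E]
  [NormedAddCommGroup F] [NormedSpace ℝ F]

/-- Iterated directional derivatives along a list of directions. -/
noncomputable def iterDir : List E → (E → F) → E → F
  | [], f => f
  | v :: l, f => fun x => fderiv ℝ (iterDir l f) x v

theorem contDiff_iterDir {f : E → F} (hf : ContDiff ℝ ∞ f) (l : List E) :
    ContDiff ℝ ∞ (iterDir l f) := by
  induction l with
  | nil => exact hf
  | cons v l ih =>
    have h : ContDiff ℝ ∞ (fderiv ℝ (iterDir l f)) := ih.fderiv_right (by simp)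
    exact h.clm_apply contDiff_const

theorem iteratedFDeriv_eq_iterDir {f : E → F} (hf : ContDiff ℝ ∞ f) {k : ℕ} (m : Fin k → E)
    (x : E) : iteratedFDeriv ℝ k f x m = iterDir (List.ofFn m) f x := by
  induction k generalizing x with
  | zero => simp [iterDir]
  | succ k ih =>
    have hd : DifferentiableAt ℝ (iteratedFDeriv ℝ k f) x :=
      hf.differentiable_iteratedFDeriv (by exact_mod_cast WithTop.coe_lt_top _) x
    rw [hd.iteratedFDeriv_succ_apply_left', List.ofFn_succ]
    change fderiv ℝ (fun y => iteratedFDeriv ℝ k f y (fun i => m i.succ)) x (m 0) =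
      fderiv ℝ (iterDir (List.ofFn fun i => m i.succ) f) x (m 0)
    congr 2
    ext1 y
    exact ih _ y

/-- Permutations are generated by adjacent swaps, which are the symmetry of the second derivative.
-/
theorem iterDir_perm {f : E → F} (hf : ContDiff ℝ ∞ f) {l l' : List E} (h : l.Perm l') :
    iterDir l f = iterDir l' f := by
  induction h with
  | nil => rfl
  | cons v _ ih => simp only [iterDir, ih]
  | swap u v l =>
    have hl := contDiff_iterDir hf l
    have hl' : ContDiff ℝ ∞ (fderiv ℝ (iterDir l f)) := hl.fderiv_right (by simp)
    ext1 x
    have key : ∀ a b : E, fderiv ℝ (fun y => fderiv ℝ (iterDir l f) y a) x b =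
        fderiv ℝ (fderiv ℝ (iterDir l f)) x b a := fun a b => by
      rw [fderiv_clm_apply (hl'.differentiable (by simp) x) (differentiableAt_const a)]
      simp
    have hsymm : IsSymmSndFDerivAt ℝ (iterDir l f) x :=
      (hl.of_le (show (2 : WithTop ℕ∞) ≤ ((⊤ : ℕ∞) : WithTop ℕ∞) by
        exact WithTop.coe_le_coe.2 (le_top : (2 : ℕ∞) ≤ ⊤))).contDiffAt.isSymmSndFDerivAt (by simp)
    simp only [iterDir, key]
    exact hsymm v u
  | trans _ _ ih₁ ih₂ => exact ih₁.trans ih₂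

theorem iteratedFDeriv_comp_equiv {f : E → F} (hf : ContDiff ℝ ∞ f) {k l : ℕ}
    (e : Fin l ≃ Fin k) (m : Fin k → E) (x : E) :
    iteratedFDeriv ℝ l f x (m ∘ e) = iteratedFDeriv ℝ k f x m := by
  obtain rfl : l = k := by simpa using Fintype.card_congr e
  rw [iteratedFDeriv_eq_iterDir hf, iteratedFDeriv_eq_iterDir hf,
    iterDir_perm hf (Equiv.Perm.ofFn_comp_perm e m)]

variable {n : ℕ}

/-- α counts how often each direction occurs in I, and e sorts I into the block order of
`multiDeriv`; symmetry makes the order irrelevant. -/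
theorem exists_multiDeriv_eq {f : Eucl n → ℝ} (hf : ContDiff ℝ ∞ f) {k : ℕ} (I : Fin k → Fin n) :
    ∃ α : Fin n → ℕ, ∑ i, α i = k ∧ ∀ x,
      iteratedFDeriv ℝ k f x (fun j => EuclideanSpace.single (I j) (1 : ℝ)) = multiDeriv α f x := by
  let α : Fin n → ℕ := fun i => Fintype.card {j // I j = i}
  let e : Fin (∑ i, α i) ≃ Fin k := finSigmaFinEquiv.symm.trans
    ((Equiv.sigmaCongrRight fun i => (Fintype.equivFin {j // I j = i}).symm).trans
      (Equiv.sigmaFiberEquiv I))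
  have he : ∀ j, I (e j) = (finSigmaFinEquiv.symm j).1 := fun j =>
    ((Fintype.equivFin {l // I l = (finSigmaFinEquiv.symm j).1}).symm
      (finSigmaFinEquiv.symm j).2).2
  refine ⟨α, by simpa using Fintype.card_congr e, fun x => ?_⟩
  rw [← iteratedFDeriv_comp_equiv hf e, multiDeriv]
  congr 1
  ext1 j
  simp only [Function.comp_apply, he]

theorem norm_multiDeriv_le {f : Eucl n → ℝ} (α : Fin n → ℕ) (x : Eucl n) :
    ‖multiDeriv α f x‖ ≤ ‖iteratedFDeriv ℝ (∑ i, α i) f x‖ := by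
  refine (ContinuousMultilinearMap.le_opNorm _ _).trans (le_of_eq ?_)
  simp

theorem iteratedFDeriv_apply_coord {f : Eucl n → Eucl n} (hf : ContDiff ℝ ∞ f) (k : ℕ)
    (i : Fin n) (x : Eucl n) (m : Fin k → Eucl n) :
    iteratedFDeriv ℝ k (fun y => f y i) x m = iteratedFDeriv ℝ k f x m i := by
  have h := (EuclideanSpace.proj (𝕜 := ℝ) i).iteratedFDeriv_comp_left (f := f) (x := x)
    (i := k)
    (hf.contDiffAt.of_le (m := (k : WithTop ℕ∞)) (by exact_mod_cast le_top)) le_rfl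
  exact congrArg (fun T => T m) h

theorem norm_iteratedFDeriv_coord_le {f : Eucl n → Eucl n} (hf : ContDiff ℝ ∞ f) (k : ℕ)
    (i : Fin n) (x : Eucl n) :
    ‖iteratedFDeriv ℝ k (fun y => f y i) x‖ ≤ ‖iteratedFDeriv ℝ k f x‖ := by
  refine ContinuousMultilinearMap.opNorm_le_bound (norm_nonneg _) fun m => ?_
  rw [iteratedFDeriv_apply_coord hf]
  exact (PiLp.norm_apply_le _ i).trans (ContinuousMultilinearMap.le_opNorm _ _)

theorem norm_le_sum_coord {k : ℕ} (T : Eucl n [×k]→L[ℝ] Eucl n) :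
    ‖T‖ ≤ ∑ i : Fin n, ∑ I : Fin k → Fin n,
      ‖T (fun j => EuclideanSpace.single (I j) (1 : ℝ)) i‖ := by
  refine ContinuousMultilinearMap.opNorm_le_bound
    (sum_nonneg fun _ _ => sum_nonneg fun _ _ => norm_nonneg _) fun m => ?_
  have hm : T m = ∑ I : Fin k → Fin n, (∏ j, m j (I j)) •
      T (fun j => EuclideanSpace.single (I j) (1 : ℝ)) := by
    have h1 : m = fun j => ∑ i, m j i • EuclideanSpace.single i (1 : ℝ) := by
      ext j i
      simp [Finset.sum_apply, Pi.single_apply]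
    conv_lhs => rw [h1]
    rw [ContinuousMultilinearMap.map_sum]
    exact sum_congr rfl fun I _ => T.map_smul_univ _ _
  have hcoord : ∀ v : Eucl n, ‖v‖ ≤ ∑ i, ‖v i‖ := fun v => by
    have h1 : v = ∑ i, v i • EuclideanSpace.single i (1 : ℝ) := by
      ext i
      simp [Finset.sum_apply, Pi.single_apply]
    conv_lhs => rw [h1]
    refine (norm_sum_le _ _).trans (le_of_eq (sum_congr rfl fun i _ => ?_))
    simp [norm_smul]
  refine (hcoord _).trans ?_
  rw [sum_mul]
  refine sum_le_sum fun i _ => ?_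
  rw [hm, sum_mul]
  have h2 : (∑ I : Fin k → Fin n, (∏ j, m j (I j)) •
      T (fun j => EuclideanSpace.single (I j) (1 : ℝ))) i = ∑ I : Fin k → Fin n, (∏ j, m j (I j)) *
      T (fun j => EuclideanSpace.single (I j) (1 : ℝ)) i := by
    simp [Finset.sum_apply]
  rw [h2]
  refine (norm_sum_le _ _).trans (sum_le_sum fun I _ => ?_)
  rw [norm_mul, mul_comm, norm_prod]
  gcongr with j _
  exact PiLp.norm_apply_le _ _

end Partial

/-! ### The class W: embedding into 𝓑 and composition -/

section SobolevClass

open Finset Filter Topology MeasureTheory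

theorem Box.forall_fintype {ι : Type*} [Fintype ι] {t : ClassType} {P : ι → ℝ → Prop}
    (hmono : ∀ i ρ σ, 0 < ρ → ρ ≤ σ → P i ρ → P i σ) (h : ∀ i, Box t (P i)) :
    Box t fun ρ => ∀ i, P i ρ := by
  cases t with
  | beurling => exact fun ρ hρ i => h i ρ hρ
  | roumieu =>
    choose ρ hρ hP using h
    have hle : ∀ i, ρ i ≤ ∑ j, ρ j + 1 := fun i =>
      (single_le_sum (fun j _ => (hρ j).le) (mem_univ i)).trans (by linarith)
    exact ⟨∑ j, ρ j + 1, add_pos_of_nonneg_of_pos (sum_nonneg fun j _ => (hρ j).le) one_pos,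
      fun i => hmono i _ _ (hρ i) (hle i) (hP i)⟩

theorem Box.scale {t : ClassType} {P Q : ℝ → Prop} {a : ℝ} (ha : 0 < a)
    (h : ∀ ρ, 0 < ρ → P ρ → Q (a * ρ)) (hP : Box t P) : Box t Q := by
  cases t with
  | beurling =>
    intro r hr
    have := h (r / a) (by positivity) (hP _ (by positivity))
    rwa [mul_div_cancel₀ _ ha.ne'] at this
  | roumieu =>
    obtain ⟨ρ, hρ, hp⟩ := hP
    exact ⟨a * ρ, by positivity, h ρ hρ hp⟩

variable {n : ℕ}

/-- The class `W^{[M],p}` described by the `L^p`-norms of the operator norms of the Fréchet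
derivatives. -/
def MemWNorm (t : ClassType) (M : ℕ → ℝ) (p : ℝ≥0∞) (f : Eucl n → Eucl n) : Prop :=
  ContDiff ℝ ∞ f ∧ Box t fun ρ => ∃ C : ℝ, ∀ k : ℕ,
    eLpNorm (iteratedFDeriv ℝ k f) p volume ≤
      ENNReal.ofReal (C * (ρ ^ k * (k.factorial : ℝ) * M k))

theorem continuous_multiDeriv {f : Eucl n → ℝ} (hf : ContDiff ℝ ∞ f) (α : Fin n → ℕ) :
    Continuous (multiDeriv α f) :=
  have h : Continuous (iteratedFDeriv ℝ (∑ i, α i) f) :=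
    hf.continuous_iteratedFDeriv (by exact_mod_cast le_top)
  (ContinuousMultilinearMap.apply ℝ (fun _ : Fin (∑ i, α i) => Eucl n) ℝ
    (fun j => EuclideanSpace.single (finSigmaFinEquiv.symm j).1 (1 : ℝ))).continuous.comp h

theorem MemWNorm.memW {t : ClassType} {M : ℕ → ℝ} {p : ℝ≥0∞} {f : Eucl n → Eucl n}
    (hf : MemWNorm t M p f) : MemW t M p f := fun i =>
  ⟨contDiff_euclidean.1 hf.1 i, hf.2.imp fun _ _ ⟨C, hC⟩ => ⟨C, fun α =>
    (eLpNorm_mono fun x => (norm_multiDeriv_le α x).trans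
      (norm_iteratedFDeriv_coord_le hf.1 _ i x)).trans (hC _)⟩⟩

theorem MemW.memWNorm {t : ClassType} {M : ℕ → ℝ} (hM : IsLogConvexWeight M) {p : ℝ≥0∞}
    (hp : 1 ≤ p) {f : Eucl n → Eucl n} (hf : MemW t M p f) : MemWNorm t M p f := by
  have hfs : ContDiff ℝ ∞ f := contDiff_euclidean.2 fun i => (hf i).1
  -- Expanding in the standard basis gives n · n^k terms. The factor n^k is absorbed by enlarging
  -- the radius by n + 1, which is positive even for n = 0.
  refine ⟨hfs, Box.scale (a := n + 1) (by positivity) (fun ρ hρ h => ?_)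
    (Box.forall_fintype (fun i ρ σ hρ hρσ ⟨C, hC⟩ => ⟨max C 0, fun α => (hC α).trans
      (ENNReal.ofReal_le_ofReal (bound_mono hM hρ hρσ (le_max_left _ _) (le_max_right _ _) _))⟩)
      fun i => (hf i).2)⟩
  choose C hC using h
  have hC0 : 0 ≤ ∑ i, |C i| := sum_nonneg fun _ _ => abs_nonneg _
  refine ⟨n * ∑ i, |C i|, fun k => ?_⟩
  have hMk := (hM.pos k).le
  set T : ℝ := (∑ i, |C i|) * (ρ ^ k * k.factorial * M k) with hT
  have hT0 : 0 ≤ T := by positivity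
  choose α hα hα' using fun (i : Fin n) (I : Fin k → Fin n) => exists_multiDeriv_eq (hf i).1 I
  have hterm : ∀ i I, eLpNorm (fun x => ‖multiDeriv (α i I) (fun y => f y i) x‖) p volume ≤
      ENNReal.ofReal T := fun i I => by
    rw [eLpNorm_norm]
    refine (hC i (α i I)).trans (ENNReal.ofReal_le_ofReal ?_)
    rw [hα]
    exact bound_mono hM hρ le_rfl ((le_abs_self _).trans
      (single_le_sum (f := fun i => |C i|) (fun _ _ => abs_nonneg _) (mem_univ i))) hC0 k
  have hmeas : ∀ i I, AEStronglyMeasurable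
      (fun x => ‖multiDeriv (α i I) (fun y => f y i) x‖) volume := fun i I =>
    (continuous_multiDeriv (hf i).1 _).norm.aestronglyMeasurable
  calc eLpNorm (iteratedFDeriv ℝ k f) p volume
      ≤ eLpNorm (∑ i, ∑ I, fun x => ‖multiDeriv (α i I) (fun y => f y i) x‖) p volume := by
        refine eLpNorm_mono_real fun x => (norm_le_sum_coord _).trans (le_of_eq ?_)
        simp only [Finset.sum_apply, ← hα', iteratedFDeriv_apply_coord hfs]
    _ ≤ ∑ i : Fin n, ∑ I : Fin k → Fin n, ENNReal.ofReal T := by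
        refine (eLpNorm_sum_le (fun i _ => Finset.aestronglyMeasurable_sum _ fun I _ => hmeas i I)
          hp).trans (sum_le_sum fun i _ => ?_)
        exact (eLpNorm_sum_le (fun I _ => hmeas i I) hp).trans
          (sum_le_sum fun I _ => hterm i I)
    _ = ENNReal.ofReal (n * (n ^ k * T)) := by
        simp only [sum_const, card_univ, Fintype.card_fin, Fintype.card_fun, nsmul_eq_mul,
          Nat.cast_pow]
        rw [ENNReal.ofReal_mul (p := (n : ℝ)) (by positivity),
          ENNReal.ofReal_mul (p := (n : ℝ) ^ k) (by positivity),
          ENNReal.ofReal_pow (by positivity), ENNReal.ofReal_natCast]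
    _ ≤ _ := by
        refine ENNReal.ofReal_le_ofReal ?_
        calc (n : ℝ) * (n ^ k * T) ≤ n * ((n + 1) ^ k * T) := by gcongr; linarith
          _ = _ := by rw [hT, mul_pow]; ring

theorem memWNorm_zero {t : ClassType} {M : ℕ → ℝ} {p : ℝ≥0∞} :
    MemWNorm t M p (0 : Eucl n → Eucl n) :=
  ⟨contDiff_const, Box.of_forall fun ρ _ => ⟨0, fun k => by
    rw [show iteratedFDeriv ℝ k (0 : Eucl n → Eucl n) = 0 from iteratedFDeriv_fun_zero]
    simp⟩⟩

theorem MemWNorm.neg {t : ClassType} {M : ℕ → ℝ} {p : ℝ≥0∞} {f : Eucl n → Eucl n}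
    (hf : MemWNorm t M p f) : MemWNorm t M p (-f) :=
  ⟨hf.1.neg, hf.2.imp fun ρ _ ⟨C, hC⟩ => ⟨C, fun k => by
    refine le_trans (eLpNorm_mono fun x => ?_) (hC k)
    rw [iteratedFDeriv_neg_apply, norm_neg]⟩⟩

theorem MemWNorm.add {t : ClassType} {M : ℕ → ℝ} (hM : IsLogConvexWeight M) {p : ℝ≥0∞}
    (hp : 1 ≤ p) {f g : Eucl n → Eucl n} (hf : MemWNorm t M p f) (hg : MemWNorm t M p g) :
    MemWNorm t M p (f + g) := by
  have hmono : ∀ f : Eucl n → Eucl n, ∀ ρ σ : ℝ, 0 < ρ → ρ ≤ σ →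
      (∃ C : ℝ, 0 ≤ C ∧ ∀ k : ℕ, eLpNorm (iteratedFDeriv ℝ k f) p volume ≤
        ENNReal.ofReal (C * (ρ ^ k * (k.factorial : ℝ) * M k))) →
      ∃ C : ℝ, 0 ≤ C ∧ ∀ k : ℕ, eLpNorm (iteratedFDeriv ℝ k f) p volume ≤
        ENNReal.ofReal (C * (σ ^ k * (k.factorial : ℝ) * M k)) :=
    fun f ρ σ hρ h ⟨C, hC0, hC⟩ => ⟨C, hC0, fun k => (hC k).trans
      (ENNReal.ofReal_le_ofReal (bound_mono hM hρ h le_rfl hC0 k))⟩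
  have hpos : ∀ f : Eucl n → Eucl n, MemWNorm t M p f → Box t fun ρ => ∃ C : ℝ, 0 ≤ C ∧ ∀ k : ℕ,
      eLpNorm (iteratedFDeriv ℝ k f) p volume ≤
        ENNReal.ofReal (C * (ρ ^ k * (k.factorial : ℝ) * M k)) := fun f hf =>
    hf.2.imp fun ρ hρ ⟨C, hC⟩ => ⟨max C 0, le_max_right _ _, fun k => (hC k).trans
      (ENNReal.ofReal_le_ofReal (bound_mono hM hρ le_rfl (le_max_left _ _) (le_max_right _ _) k))⟩
  refine ⟨hf.1.add hg.1, Box.and (hmono f) (hmono g)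
    (fun ρ hρ ⟨C, hC0, hC⟩ ⟨D, hD0, hD⟩ => ⟨C + D, fun k => ?_⟩) (hpos f hf) (hpos g hg)⟩
  have hMk := (hM.pos k).le
  have hfk : Continuous (iteratedFDeriv ℝ k f) :=
    hf.1.continuous_iteratedFDeriv (by exact_mod_cast le_top)
  have hgk : Continuous (iteratedFDeriv ℝ k g) :=
    hg.1.continuous_iteratedFDeriv (by exact_mod_cast le_top)
  rw [show iteratedFDeriv ℝ k (f + g) = iteratedFDeriv ℝ k f + iteratedFDeriv ℝ k g from
    iteratedFDeriv_add (hf.1.of_le (by exact_mod_cast le_top))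
      (hg.1.of_le (by exact_mod_cast le_top)), add_mul,
    ENNReal.ofReal_add (by positivity) (by positivity)]
  exact (eLpNorm_add_le hfk.aestronglyMeasurable hgk.aestronglyMeasurable hp).trans
    (add_le_add (hC k) (hD k))

theorem MemWNorm.memLp {t : ClassType} {M : ℕ → ℝ} {p : ℝ≥0∞} {f : Eucl n → Eucl n}
    (hf : MemWNorm t M p f) (k : ℕ) : MemLp (fun y => ‖iteratedFDeriv ℝ k f y‖) p volume := by
  obtain ⟨ρ, -, C, hC⟩ := hf.2.exists
  have hk : Continuous (iteratedFDeriv ℝ k f) :=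
    hf.1.continuous_iteratedFDeriv (by exact_mod_cast le_top)
  refine ⟨hk.norm.aestronglyMeasurable, ?_⟩
  rw [eLpNorm_norm]
  exact (hC k).trans_lt ENNReal.ofReal_lt_top

theorem IsWeightSequence.exists_le_pow_mul {t : ClassType} {M : ℕ → ℝ}
    (hM : IsWeightSequence t M) :
    ∃ A : ℝ, 1 ≤ A ∧ ∀ j k, M (j + k) ≤ A ^ (j + k) * (M j * M k) := by
  obtain ⟨C, hC, h⟩ := hM.moderateGrowth
  refine ⟨max C 1, le_max_right _ _, fun j k => ?_⟩
  have hp : (1 : ℝ) ≤ max C 1 ^ (j + k) := one_le_pow₀ (le_max_right _ _)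
  have h1 := (hM.one_le j).trans' zero_le_one
  have h2 := (hM.one_le k).trans' zero_le_one
  rcases Nat.eq_zero_or_pos j with rfl | hj
  · rw [hM.zero, one_mul]
    simp only [zero_add] at hp ⊢
    exact le_mul_of_one_le_left h2 hp
  rcases Nat.eq_zero_or_pos k with rfl | hk
  · rw [hM.zero, mul_one]
    simp only [add_zero] at hp ⊢
    exact le_mul_of_one_le_left h1 hp
  refine (h j k hj hk).trans ?_
  gcongr
  exact le_max_left _ _

/-- The Sobolev inequality costs l ≤ n derivatives. Moderate growth and (k+l)! ≤ 2^(k+l) k! l!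
separate k from l: the l-part goes into the constant, and the radius grows by the factor 2A. -/
theorem MemWNorm.memB {t : ClassType} {M : ℕ → ℝ} (hM : IsWeightSequence t M) {p : ℝ≥0∞}
    (hp : 1 ≤ p) {f : Eucl n → Eucl n} (hf : MemWNorm t M p f) : MemB t M f := by
  obtain ⟨A, hA, hAM⟩ := hM.exists_le_pow_mul
  refine ⟨hf.1, Box.scale (a := 2 * A) (by positivity) (fun ρ hρ ⟨C, hC⟩ => ?_) hf.2⟩
  have hM0 := fun k => (hM.one_le k).trans' zero_le_one
  have hC0 := le_max_right C 0
  refine ⟨2 ^ n * ∑ l ∈ range (n + 1), max C 0 * ((2 * A * ρ) ^ l * l.factorial * M l),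
    fun k x => ?_⟩
  have hMk := hM0 k
  have hl : ∀ l, eLpNorm (fun y => ‖iteratedFDeriv ℝ (k + l) f y‖) p
      (volume.restrict (unitCube x)) ≤ ENNReal.ofReal
        (max C 0 * ((2 * A * ρ) ^ l * l.factorial * M l) *
          ((2 * A * ρ) ^ k * k.factorial * M k)) := fun l => by
    have hMl := hM0 l
    have hfac : ((k + l).factorial : ℝ) ≤ 2 ^ (k + l) * (k.factorial * l.factorial) := by
      rw [← Nat.add_choose_mul_factorial_mul_factorial, mul_assoc]
      push_cast
      gcongr
      exact_mod_cast Nat.choose_le_two_pow _ _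
    rw [eLpNorm_norm]
    refine (eLpNorm_mono_measure _ Measure.restrict_le_self).trans ((hC _).trans
      (ENNReal.ofReal_le_ofReal ?_))
    refine (bound_mono hM.isLogConvexWeight hρ le_rfl (le_max_left _ _) hC0 _).trans ?_
    calc max C 0 * (ρ ^ (k + l) * (k + l).factorial * M (k + l))
        ≤ max C 0 * (ρ ^ (k + l) * (2 ^ (k + l) * (k.factorial * l.factorial)) *
          (A ^ (k + l) * (M k * M l))) := by
          have := hM0 (k + l)
          gcongr
          exact hAM k l
      _ = _ := by
          rw [mul_pow (2 * A), mul_pow (2 * A), mul_pow 2 A, mul_pow 2 A]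
          ring
  have h1 := (enorm_iteratedFDeriv_le_eLpNorm_restrict hf.1 hp k x).trans
    (mul_le_mul_right (sum_le_sum fun l _ => hl l) _)
  have hnn : ∀ l, 0 ≤ max C 0 * ((2 * A * ρ) ^ l * l.factorial * M l) *
      ((2 * A * ρ) ^ k * k.factorial * M k) := fun l => by
    have := hM0 l
    positivity
  rw [← ENNReal.ofReal_sum_of_nonneg fun l _ => hnn l, ← Finset.sum_mul,
    show (2 : ℝ≥0∞) ^ n = ENNReal.ofReal (2 ^ n) by simp [ENNReal.ofReal_pow],
    ← ENNReal.ofReal_mul (by positivity), ← mul_assoc, ← ofReal_norm] at h1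
  refine (ENNReal.ofReal_le_ofReal_iff ?_).1 h1
  have : 0 ≤ ∑ l ∈ range (n + 1), max C 0 * ((2 * A * ρ) ^ l * l.factorial * M l) :=
    sum_nonneg fun l _ => by have := hM0 l; positivity
  positivity

/-- By change of variables the volume of s is the integral of |det G'| over its preimage, hence at
least c times the volume of the preimage. -/
theorem map_volume_le_smul {G : Eucl n → Eucl n} (hG : ContDiff ℝ 1 G)
    (hbij : Function.Bijective G) {c : ℝ} (hc : 0 < c) (h : ∀ x, c ≤ (fderiv ℝ G x).det) :
    (volume : Measure (Eucl n)).map G ≤ ENNReal.ofReal c⁻¹ • volume := by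
  refine Measure.le_iff.2 fun s hs => ?_
  have hms : MeasurableSet (G ⁻¹' s) := hG.continuous.measurable hs
  have h1 := lintegral_abs_det_fderiv_eq_addHaar_image (volume : Measure (Eucl n)) hms
    (fun x _ => (hG.differentiable (by simp) x).hasFDerivAt.hasFDerivWithinAt)
    hbij.injective.injOn
  rw [Set.image_preimage_eq _ hbij.surjective] at h1
  rw [Measure.map_apply hG.continuous.measurable hs, Measure.smul_apply, smul_eq_mul, ← h1]
  have h2 : ENNReal.ofReal c * volume (G ⁻¹' s) ≤
      ∫⁻ x in G ⁻¹' s, ENNReal.ofReal |(fderiv ℝ G x).det| := by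
    rw [← setLIntegral_const]
    exact lintegral_mono fun x => ENNReal.ofReal_le_ofReal ((h x).trans (le_abs_self _))
  calc volume (G ⁻¹' s) = ENNReal.ofReal c⁻¹ * (ENNReal.ofReal c * volume (G ⁻¹' s)) := by
        rw [← mul_assoc, ← ENNReal.ofReal_mul (by positivity), inv_mul_cancel₀ hc.ne']
        simp
    _ ≤ _ := by gcongr

theorem eLpNorm_comp_le {G : Eucl n → Eucl n} (hG : ContDiff ℝ 1 G)
    (hbij : Function.Bijective G) {c : ℝ} (hc : 0 < c) (h : ∀ x, c ≤ (fderiv ℝ G x).det)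
    {p : ℝ≥0∞} (hp_top : p ≠ ⊤) : ∃ κ : ℝ, 0 ≤ κ ∧ ∀ u : Eucl n → ℝ, Continuous u →
      eLpNorm (u ∘ G) p volume ≤ ENNReal.ofReal κ * eLpNorm u p volume := by
  refine ⟨(c⁻¹) ^ (1 / p).toReal, by positivity, fun u hu => ?_⟩
  rw [← eLpNorm_map_measure hu.aestronglyMeasurable hG.continuous.aemeasurable]
  refine (eLpNorm_mono_measure u (map_volume_le_smul hG hbij hc h)).trans (le_of_eq ?_)
  rw [eLpNorm_smul_measure_of_ne_top hp_top, ENNReal.ofReal_rpow_of_nonneg (by positivity)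
    (by positivity), smul_eq_mul]

/-- Minkowski's inequality is applied to the pointwise Faà di Bruno bound. Its terms are derivatives
of f composed with G, whose L^p norms grow only by the Jacobian constant κ. -/
theorem MemWNorm.comp {t : ClassType} {M : ℕ → ℝ} (hM : IsLogConvexWeight M) {p : ℝ≥0∞}
    (hp : 1 ≤ p) (hp_top : p ≠ ⊤) {f G : Eucl n → Eucl n} (hf : MemWNorm t M p f)
    (hG : ContDiff ℝ ∞ G) (hGM : HasBoundedDerivs t M G) (hbij : Function.Bijective G) {c : ℝ}
    (hc : 0 < c) (hdet : ∀ x, c ≤ (fderiv ℝ G x).det) : MemWNorm t M p (f ∘ G) := by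
  obtain ⟨κ, hκ, hκu⟩ := eLpNorm_comp_le (hG.of_le (by simp)) hbij hc hdet hp_top
  refine ⟨hf.1.comp hG, Box.comp (fun ρ hρ hP => ?_) hGM hf.2⟩
  obtain ⟨B, hB, h⟩ := exists_norm_iteratedFDeriv_comp_le (F := Eucl n) hM hG hρ hP
  refine ⟨B, hB, fun σ hσ ⟨C, hC⟩ r hr h1 h2 => ⟨κ * max C 0, fun k => ?_⟩⟩
  have hM0 := fun k => (hM.pos k).le
  have hMk := hM0 k
  have hC0 := le_max_right C 0
  have hcont : ∀ j, Continuous (iteratedFDeriv ℝ j f) := fun j =>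
    hf.1.continuous_iteratedFDeriv (by exact_mod_cast le_top)
  set b : ℕ → ℝ := fun j => B ^ j / (j.factorial * M j) with hb
  have hb0 : ∀ j, 0 ≤ b j := fun j => by have := hM0 j; positivity
  set a : ℝ := k.factorial * M k * (4 * ρ) ^ k with ha
  have ha0 : 0 ≤ a := by positivity
  have hterm : ∀ j, eLpNorm (fun x => b j * ‖iteratedFDeriv ℝ j f (G x)‖) p volume ≤
      ENNReal.ofReal (κ * max C 0 * (B * σ) ^ j) := fun j => by
    have h3 : eLpNorm (fun x => ‖iteratedFDeriv ℝ j f (G x)‖) p volume ≤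
        ENNReal.ofReal κ * ENNReal.ofReal (max C 0 * (σ ^ j * j.factorial * M j)) := by
      refine (hκu _ (hcont j).norm).trans ?_
      rw [eLpNorm_norm]
      gcongr
      exact (hC j).trans (ENNReal.ofReal_le_ofReal
        (bound_mono hM hσ le_rfl (le_max_left _ _) hC0 j))
    have h4 : eLpNorm (fun x => b j * ‖iteratedFDeriv ℝ j f (G x)‖) p volume ≤
        ENNReal.ofReal (b j) * eLpNorm (fun x => ‖iteratedFDeriv ℝ j f (G x)‖) p volume := by
      refine (eLpNorm_const_smul_le (c := b j)).trans (le_of_eq ?_)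
      rw [Real.enorm_eq_ofReal (hb0 j)]
    refine h4.trans ((mul_le_mul_right h3 _).trans (le_of_eq ?_))
    rw [← ENNReal.ofReal_mul hκ, ← ENNReal.ofReal_mul (hb0 j)]
    congr 1
    have := hM.pos j
    rw [hb, mul_pow]
    field_simp
  have hmeas : ∀ j, AEStronglyMeasurable
      (fun x => b j * ‖iteratedFDeriv ℝ j f (G x)‖) volume := fun j =>
    (continuous_const.mul ((hcont j).comp hG.continuous).norm).aestronglyMeasurable
  calc eLpNorm (iteratedFDeriv ℝ k (f ∘ G)) p volume
      ≤ eLpNorm (a • ∑ j ∈ range (k + 1), fun x => b j * ‖iteratedFDeriv ℝ j f (G x)‖) p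
          volume := by
        refine eLpNorm_mono_real fun x => (h f hf.1 k x).trans (le_of_eq ?_)
        simp only [Pi.smul_apply, Finset.sum_apply, smul_eq_mul, hb, ha]
        congr 1
        exact sum_congr rfl fun j _ => by ring
    _ ≤ ENNReal.ofReal a * ∑ j ∈ range (k + 1), ENNReal.ofReal (κ * max C 0 * (B * σ) ^ j) := by
        refine eLpNorm_const_smul_le.trans ?_
        rw [Real.enorm_eq_ofReal ha0]
        gcongr
        exact (eLpNorm_sum_le (fun j _ => hmeas j) hp).trans (sum_le_sum fun j _ => hterm j)
    _ = ENNReal.ofReal (a * (κ * max C 0 * ∑ j ∈ range (k + 1), (B * σ) ^ j)) := by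
        rw [← ENNReal.ofReal_sum_of_nonneg fun j _ => by positivity, ← ENNReal.ofReal_mul ha0,
          ← mul_sum]
    _ ≤ _ := by
        refine ENNReal.ofReal_le_ofReal ?_
        calc a * (κ * max C 0 * ∑ j ∈ range (k + 1), (B * σ) ^ j)
            ≤ a * (κ * max C 0 * (1 + B * σ) ^ k) := by
              gcongr
              exact sum_range_pow_le_one_add_pow (by positivity) k
          _ = κ * max C 0 * ((4 * ρ * (1 + B * σ)) ^ k * k.factorial * M k) := by
              rw [ha, mul_pow (4 * ρ)]; ring
          _ ≤ _ := by gcongr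

theorem isGroupUnderComposition_diffW {t : ClassType} {M : ℕ → ℝ} (hM : IsWeightSequence t M)
    {p : ℝ≥0∞} (hp : 1 ≤ p) (hp_top : p ≠ ⊤) : IsGroupUnderComposition (DiffW n t M p) := by
  have hlc := hM.isLogConvexWeight
  have hW : ∀ f : Eucl n → Eucl n, MemW t M p f → MemWNorm t M p f := fun f hf =>
    hf.memWNorm hlc hp
  refine isGroupUnderComposition_of_class_of_tendsto hM (MemW t M p) memWNorm_zero.memW
    (fun f g hf hg => ((hW f hf).add hlc hp (hW g hg)).memW) (fun f hf => (hW f hf).neg.memW)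
    (fun f hf => (hW f hf).memB hM hp)
    (fun f hf => tendsto_fderiv_of_memLp (hW f hf).1 hp hp_top (hW f hf).memLp) ?_
  rintro f g hf hg ⟨c, hc, hgc⟩ hbij
  refine ((hW f hf).comp hlc hp hp_top (contDiff_id_add hg.1)
    ((hasBoundedDerivs_id hM).add hlc contDiff_id hg.1 hg.hasBoundedDerivs) hbij hc
    fun x => ?_).memW
  rw [det_fderiv_id_add hg.1]
  exact hgc x

end SobolevClass

end DenjoyCarleman

/-! ### The four groups -/

theorem proposition8p5 (n : ℕ) (t : DenjoyCarleman.ClassType) (M L : ℕ → ℝ)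
    (hM : DenjoyCarleman.IsWeightSequence t M) (hL : ∀ k : ℕ, 1 ≤ L k)
    (p : ℝ≥0∞) (hp : 1 ≤ p) (hp_top : p ≠ ⊤) :
    DenjoyCarleman.IsGroupUnderComposition (DenjoyCarleman.DiffB n t M) ∧
    DenjoyCarleman.IsGroupUnderComposition (DenjoyCarleman.DiffW n t M p) ∧
    DenjoyCarleman.IsGroupUnderComposition (DenjoyCarleman.DiffS n t L M) ∧
    DenjoyCarleman.IsGroupUnderComposition (DenjoyCarleman.DiffD n t M) :=
  ⟨DenjoyCarleman.isGroupUnderComposition_diffB hM,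
    DenjoyCarleman.isGroupUnderComposition_diffW hM hp hp_top,
    DenjoyCarleman.isGroupUnderComposition_diffS hM hL,
    DenjoyCarleman.isGroupUnderComposition_diffD hM⟩
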